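/- Let $F$ be a field; all Lie algebras and modules are finite dimensional over $F$. For a Lie algebra $\mathfrak g$ with solvable radical $\mathfrak r$ put $\mathfrak n=[\mathfrak g,\mathfrak r]$ (so $\mathfrak n=[\mathfrak g,\mathfrak g]$ when $\mathfrak g$ is solvable). A $\mathfrak g$-module $U$ is *admissible* if $U\neq 0$ and $\mathfrak n$ acts on $U$ by nilpotent operators. Its *nilpotency series* $0=U^{(0)}\subset U^{(1)}\subset\cdots\subset U^{(m)}=U$ is defined by letting $U^{(i)}/U^{(i-1)}$ be the space of all vectors of $U/U^{(i-1)}$ annihilated by $\mathfrak n$; the least $m$ with $U^{(m)}=U$ is the *nilpotency length*. A module is *uniserial* if its submodules form a chain. $U$ is *linked* if it is admissible and every nilpotency factor $U^{(i)}/U^{(i-1)}$ is uniserial over $\mathfrak g/\mathfrak n$. **Theorem.** Let $\mathfrak g=\langle x\rangle\ltimes\mathfrak a$ with $x\ne 0$, where $\mathfrak a$ is an abelian ideal on which $\mathrm{ad}\,x$ acts diagonalizably. Let $\mathfrak a_0=\{u\in\mathfrak a: [x,u]=0\}$. Suppose that $F$ is infinite and perfect, or that $\mathfrak a_0=0$.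 Let $U$ be a linked $\mathfrak g$-module of nilpotency length $m>1$. (1) There are $y\in(\langle x\rangle\oplus\mathfrak a_0)\setminus\mathfrak a_0$, monic irreducible polynomials $p_1,\dots,p_m\in F[X]$ of a common degree $d$, and integers $s_1\ge\cdots\ge s_m\ge 1$ such that, for $1\le i\le m$, the factor $U^{(i)}/U^{(i-1)}$, viewed as an $F[X]$-module with $X$ acting as $y$, is uniserial and isomorphic to $F[X]/(p_i^{s_i})$, and $p_i(X)=p_1(X+i-1)$. Now let $y$, $d$, $p_i$, $s_i$ be any data as in (1), and assume that if $F$ has prime characteristic $p$, then $p\ge m$ and the only $\gamma\in F$ with $p_1(X+\gamma)=p_1(X)$ is $\gamma=0$. For $\delta\in F$ let $\mathfrak a(\delta)=\{u\in\mathfrak a:[y,u]=\delta u\}$. Let $C_i$ be the companion matrix of $p_i^{s_i}$ (ones on the subdiagonal, negatives of the coefficients of $p_i^{s_i}$ in the last column). Let $t=d(s_1+\cdots+s_m)$ and define the following $t\times t$ block matrices, with diagonal blocks of sizes $ds_1,\dots,ds_m$: $A=\mathrm{diag}(C_1,\dots,C_m)$; $E=\mathrm{diag}(C_1,C_2+I,\dots,C_m+(m-1)I)$;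 and $T$, whose only non-zero blocks are those in positions $(i-1,i)$, $2\le i\le m$, the $(k,l)$ entry of that block being the coefficient of $X^{k-1}$ in $(X-1)^{l-1}p_{i-1}(X)^{s_{i-1}-s_i}$, for $1\le k\le ds_{i-1}$, $1\le l\le ds_i$. For $n\ge 0$ let $F[X]_n$ be the space of polynomials of degree less than $n$. Then: (2) Let $S=\{\delta\in F:\mathfrak a(\delta)U\ne 0\}$. Then $1\in S$, and every element of $S$ is (the image in $F$ of) an integer $j$ with $0\le j<m$. (3) There is a basis of $U$ relative to which the following hold. The element $y$ is represented by $A$. There is a non-zero $v\in[\mathfrak g,\mathfrak g]$ with $[y,v]=v$ that is represented by $T$. For $0\le j<m$ there are linear maps $g^j:\mathfrak a(j)\to F[X]_{ds_{j+1}}$, $u\mapsto g^j_u$, such that $g^1_v=1$ and every $u\in\mathfrak a(j)$ is represented by $T^jg^j_u(E)$. In particular, the image of $\mathfrak g$ in $\mathfrak{gl}(t)$ is $$\langle A\rangle\ltimes(\mathcal E_0\oplus\mathcal E_1T\oplus\cdots\oplus\mathcal E_{m-1}T^{m-1}),\qquad \mathcal E_j=\{g^j_u(E): u\in\mathfrak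 a(j)\}.$$ (4) $U$ is uniserial as a $\mathfrak g$-module if and only if $s_1=\cdots=s_m=1$. In that case $y$ acts semisimply on $U$, and so does $x$ if $\mathfrak a_0=0$ or $d=1$. -/

import Mathlib

open Polynomial

namespace LinkedModules

noncomputable section

section LieModules

variable (F : Type*) [Field F] (L : Type*) [LieRing L] [LieAlgebra F L]
variable (M : Type*) [AddCommGroup M] [Module F M] [LieRingModule L M] [LieModule F L M]

/-- The ideal `n = [g, r]`, where `r` is the solvable radical of `g`. -/
def nilpotentRadical : LieIdeal F L :=
  ⁅(⊤ : LieIdeal F L), LieAlgebra.radical F L⁆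

/-- A Lie module is uniserial if its submodules form a chain. -/
def IsUniserialLie : Prop :=
  ∀ N N' : LieSubmodule F L M, N ≤ N' ∨ N' ≤ N

/-- A module is admissible if it is non-zero and `[g, r]` acts on it via nilpotent operators. -/
def IsAdmissible : Prop :=
  Nontrivial M ∧ ∀ v ∈ nilpotentRadical F L, IsNilpotent (LieModule.toEnd F L M v)

variable {F L M} in
/-- The submodule `N'` of `M` such that `N' / N` is the space of all vectors of `M / N`
annihilated by `n = [g, r]`. -/
def nextTerm (N : LieSubmodule F L M) : LieSubmodule F L M where
  carrier := {u | ∀ v ∈ nilpotentRadical F L, ⁅v, u⁆ ∈ N}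
  add_mem' hu hw v hv := by rw [lie_add]; exact N.add_mem (hu v hv) (hw v hv)
  zero_mem' v _ := by simp
  smul_mem' c u hu v hv := by rw [lie_smul]; exact N.smul_mem c (hu v hv)
  lie_mem {z u} hu v hv := by
    rw [leibniz_lie]
    exact N.add_mem (hu _ (lie_mem_left F L (nilpotentRadical F L) v z hv))
      (N.lie_mem (hu v hv))

/-- The nilpotency series `0 = U^(0) ⊆ U^(1) ⊆ ...`: the quotient `U^(i+1) / U^(i)` is the
0-weight space (the space of invariants) of `n` on `U / U^(i)`. -/
def nilpotencySeries : ℕ → LieSubmodule F L M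
  | 0 => ⊥
  | i + 1 => nextTerm (nilpotencySeries i)

/-- `m` is the nilpotency length of `M`: the first index with `U^(m) = U`. -/
def HasNilpotencyLength (m : ℕ) : Prop :=
  nilpotencySeries F L M m = ⊤ ∧ ∀ k, nilpotencySeries F L M k = ⊤ → m ≤ k

/-- The nilpotency factor `U^(i+1) / U^(i)`. -/
abbrev NilpotencyFactor (i : ℕ) : Type _ :=
  (nilpotencySeries F L M (i + 1)) ⧸
    (nilpotencySeries F L M i).comap (nilpotencySeries F L M (i + 1)).incl

/-- A module is linked if it is admissible and all its nilpotency factors are uniserial over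
`g / n`. As `n` acts trivially on a nilpotency factor, the `g / n`-submodules of a factor are
exactly its `g`-submodules. -/
def IsLinked : Prop :=
  IsAdmissible F L M ∧ ∀ i : ℕ, IsUniserialLie F L (NilpotencyFactor F L M i)

variable {L} in
/-- A nilpotency factor, viewed as an `F[X]`-module with `X` acting as `y`. -/
abbrev FactorVia (y : L) (i : ℕ) : Type _ :=
  Module.AEval' (LieModule.toEnd F L (NilpotencyFactor F L M i) y)

variable {F L} in
/-- The space `a(δ) = {u ∈ a | [y, u] = δ u}`. -/
def adEigenspace (a : LieIdeal F L) (y : L) (δ : F) : Submodule F L where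
  carrier := {u | u ∈ a ∧ ⁅y, u⁆ = δ • u}
  add_mem' hu hw := ⟨a.add_mem hu.1 hw.1, by rw [lie_add, hu.2, hw.2, smul_add]⟩
  zero_mem' := ⟨a.zero_mem, by simp⟩
  smul_mem' c u hu := ⟨a.smul_mem c hu.1, by rw [lie_smul, hu.2, smul_comm]⟩

end LieModules

/-- A module over `F[X]` is uniserial if its submodules form a chain. -/
def IsUniserialPoly (F : Type*) [Field F] (M : Type*) [AddCommGroup M] [Module F[X] M] : Prop :=
  ∀ N N' : Submodule F[X] M, N ≤ N' ∨ N' ≤ N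

section Matrices

variable {F : Type*} [Field F]

/-- The companion matrix of a monic polynomial `f` of degree `n`: ones right below the diagonal,
and last column `-f_0, ..., -f_{n-1}`. -/
def companion (n : ℕ) (f : F[X]) : Matrix (Fin n) (Fin n) F := fun i j =>
  if (j : ℕ) + 1 = n then -f.coeff i else if (i : ℕ) = (j : ℕ) + 1 then 1 else 0

variable {m : ℕ}

/-- The indices of the rows and columns of block matrices with `m` diagonal blocks of sizes
`d s_1, ..., d s_m`. -/
abbrev BlockIndex (d : ℕ) (s : Fin m → ℕ) : Type := Σ i : Fin m, Fin (d * s i)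

/-- The block diagonal matrix `A` with diagonal blocks the companion matrices of `p_i ^ s_i`. -/
def matA (d : ℕ) (p : Fin m → F[X]) (s : Fin m → ℕ) :
    Matrix (BlockIndex d s) (BlockIndex d s) F :=
  Matrix.blockDiagonal' fun i => companion (d * s i) (p i ^ s i)

/-- The block diagonal matrix `E` with diagonal blocks `C_i + (i - 1) I`, where `C_i` is the
companion matrix of `p_i ^ s_i` (here the index `i` starts at `0`). -/
def matE (d : ℕ) (p : Fin m → F[X]) (s : Fin m → ℕ) :
    Matrix (BlockIndex d s) (BlockIndex d s) F :=
  Matrix.blockDiagonal' fun i =>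
    companion (d * s i) (p i ^ s i) + ((i : ℕ) : F) • (1 : Matrix (Fin (d * s i)) (Fin (d * s i)) F)

/-- The block matrix `T` whose only non-zero blocks are on the first block superdiagonal; column
`k` of the block in position `(i, i + 1)` consists of the coefficients of
`(X - 1) ^ k * p_i ^ (s_i - s_{i+1})`. -/
def matT (d : ℕ) (p : Fin m → F[X]) (s : Fin m → ℕ) :
    Matrix (BlockIndex d s) (BlockIndex d s) F := fun r c =>
  if (r.1 : ℕ) + 1 = c.1 then
    ((X - 1) ^ (c.2 : ℕ) * p r.1 ^ (s r.1 - s c.1)).coeff r.2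
  else 0

end Matrices

section Adapted

variable {F : Type*} [Field F] {L : Type*} [LieRing L] [LieAlgebra F L]

/-- `y` lies in `(⟨x⟩ ⊕ a_0) \ a_0`; via `y` the nilpotency factors of `U` are uniserial
`F[X]`-modules isomorphic to `F[X]/(p_i ^ s_i)` with `p_i` monic irreducible; the `p_i` have
common degree `d` and satisfy `p_i(X) = p_1(X + i - 1)`; and `s_1 ≥ ... ≥ s_m ≥ 1`. The indices
start at `0`, so that `p_1` is `p 0`. -/
structure IsAdapted (a : LieIdeal F L) (x : L)
    (U : Type*) [AddCommGroup U] [Module F U] [LieRingModule L U] [LieModule F L U]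
    {m : ℕ} (hm : 1 < m) (y : L) (d : ℕ) (p : Fin m → F[X]) (s : Fin m → ℕ) : Prop where
  mem : y ∈ Submodule.span F {x} ⊔ adEigenspace a x 0
  notMem : y ∉ adEigenspace a x 0
  uniserial : ∀ i : Fin m, IsUniserialPoly F (FactorVia F U y i)
  monic : ∀ i, (p i).Monic
  irreducible : ∀ i, Irreducible (p i)
  pos : ∀ i, 1 ≤ s i
  iso : ∀ i : Fin m, Nonempty (FactorVia F U y i ≃ₗ[F[X]] (F[X] ⧸ Ideal.span {p i ^ s i}))
  degree : ∀ i, (p i).natDegree = d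
  shift : ∀ i : Fin m, p i = (p ⟨0, by omega⟩).comp (X + C ((i : ℕ) : F))
  antitone : Antitone s

end Adapted

end

end LinkedModules

/-!
Put `n = [g, g]`; it is spanned by the eigenvectors of `ad x` in `a` with non-zero eigenvalue.

*The shift.* The kernel of the map `U^(i+2) / U^(i+1) → U^(i+1) / U^(i)` induced by such an
eigenvector is a submodule, because `a` is abelian. As the factor is uniserial, these kernels form a
chain, and their intersection is trivial by definition of the nilpotency series; hence one of them
is trivial. Since elements of `a` commute, an eigenvector `v` that is injective at the first step is
injective at all steps (`IsDiagonalSplit.exists_injective`). Scale `x` so that `[x, v] = v`.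

*A single operator.* On `U^(1)` the algebra `g / n` acts by commuting operators with a chain of
common invariant subspaces, so they generate a local uniserial algebra. Over an infinite perfect
field a generic element of the generating space generates this algebra
(`exists_adjoin_singleton_eq_top`): it has to map to a primitive element of the residue field, and
to avoid the kernel of a derivation, so that a polynomial in it generates the maximal ideal. Adding
a suitable `w₀ ∈ a_0` to `x` therefore yields `y` via which `U^(1)` is a uniserial `F[X]`-module,
and `v` carries this over to the other factors; if `a_0 = 0`, then `y = x` will do. The factors are
therefore of the form `F[X] / (p_i ^ s_i)`. As `g(y) v = v g(y + 1)`, the embedding of each factor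
into the previous one gives `p_(i+1) = p_i(X + 1)` and `s_(i+1) ≤ s_i` (`IsFactorGenerator.shift`,
`IsDiagonalSplit.exists_isAdapted`).

*Normal form.* Let the indices start at `0`, and let `q = p_0`. The polynomials `q(X + i)` with
`i < m` are pairwise distinct by the assumption on the characteristic, so `U` is the direct sum of
the primary components of `y`, the `i`-th one being isomorphic to the `i`-th factor. With
`q_i = q(X + i)`, generators `e_i` can be chosen successively so that
`v e_(i+1) = q_i(y) ^ (s_i - s_(i+1)) e_i` (`IsShiftSystem.exists_isGeneratorSystem`). In the
basis of the vectors `y ^ l e_i` the matrices of `y` and `v` are `A` and `T`.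

*The action of `a`.* An element of `a(δ)` maps the primary component of `q(X + k)` to that of
`q(X + k - δ)`, so it acts trivially unless `δ` is one of `0, ..., m - 1`. The operator `E` that is
`y + i` on the `i`-th component has annihilating polynomial `q ^ s_i` there, and commutes with all
of `g` (`IsShiftedOperator.apply_lie`). For `u ∈ a(j)` the vector `u e_j` is `v ^ j g(E) e_j` for
some `g` of degree less than `d s_j`, and commuting `u` with powers of `v` extends this to all
generators (`IsShiftedOperator.exists_lie_eq`).

*Uniseriality.* If all `s_i` are `1`, the factors are irreducible, and applying `v` repeatedly shows
that the only submodules are the `U^(i)`. Conversely, since `E` commutes with `g`, the kernel of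
`q(E)` is a submodule, and comparing it with `U^(1)` forces `s_0 = 1`, hence all `s_i = 1`
(`IsShiftedOperator.eq_one_of_isUniserialLie`).
-/

namespace LinkedModules

/-! ### Translations of polynomials -/

section Shifts

variable {F : Type*} [Field F]

theorem comp_X_add_C_comp (q : F[X]) (γ δ : F) :
    (q.comp (X + C γ)).comp (X + C δ) = q.comp (X + C (γ + δ)) := by
  rw [comp_assoc, add_comp, X_comp, C_comp, add_assoc, ← C_add, add_comm δ]

theorem irreducible_comp_X_add_C {q : F[X]} (hq : Irreducible q) (γ : F) :
    Irreducible (q.comp (X + C γ)) := by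
  have := (MulEquiv.irreducible_iff (algEquivAevalXAddC γ)).2 hq
  simpa [algEquivAevalXAddC, aeval_def, Polynomial.comp, algebraMap_eq] using this

theorem isCoprime_comp_X_add_C {q : F[X]} (hq : Irreducible q) (hqm : q.Monic)
    (hstab : ∀ γ : F, q.comp (X + C γ) = q → γ = 0) {γ δ : F} (h : γ ≠ δ) :
    IsCoprime (q.comp (X + C γ)) (q.comp (X + C δ)) := by
  refine ((irreducible_comp_X_add_C hq γ).coprime_iff_not_dvd).2 fun hdvd => h ?_
  have heq : q.comp (X + C γ) = q.comp (X + C δ) :=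
    eq_of_monic_of_associated (hqm.comp_X_add_C γ) (hqm.comp_X_add_C δ)
      ((irreducible_comp_X_add_C hq γ).associated_of_dvd (irreducible_comp_X_add_C hq δ) hdvd)
  have h₁ := congrArg (fun f : F[X] => f.comp (X + C (-δ))) heq
  simp only [comp_X_add_C_comp, add_neg_cancel, C_0, add_zero, comp_X] at h₁
  exact sub_eq_zero.1 (by rw [sub_eq_add_neg]; exact hstab _ h₁)

theorem comp_X_add_C_dvd_iff {f g : F[X]} (γ : F) :
    f.comp (X + C γ) ∣ g.comp (X + C γ) ↔ f ∣ g := by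
  refine ⟨fun h => ?_, fun ⟨k, hk⟩ => ⟨k.comp (X + C γ), by rw [hk, mul_comp]⟩⟩
  obtain ⟨k, hk⟩ := h
  refine ⟨k.comp (X + C (-γ)), ?_⟩
  have h₁ := congrArg (fun f : F[X] => f.comp (X + C (-γ))) hk
  simpa only [mul_comp, comp_X_add_C_comp, add_neg_cancel, C_0, add_zero, comp_X] using h₁

end Shifts

/-! ### Extensions of a line by an abelian ideal -/

section SplitExtension

variable {F : Type*} [Field F] {L : Type*} [LieRing L] [LieAlgebra F L]

/-- `L` is spanned by `y` and an abelian ideal `a` on which `ad y` is diagonalizable. In contrast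
with the decomposition `⟨x⟩ ⋉ a` one starts from, this is stable under replacing `x` by any
`y ∈ (⟨x⟩ ⊕ a_0) \ a_0`. -/
structure IsDiagonalSplit (a : LieIdeal F L) (y : L) : Prop where
  sup_eq_top : Submodule.span F {y} ⊔ a.toSubmodule = ⊤
  abelian : ∀ u ∈ a, ∀ v ∈ a, ⁅u, v⁆ = 0
  diagonal : ⨆ δ : F, adEigenspace a y δ = a.toSubmodule

namespace IsDiagonalSplit

variable {a : LieIdeal F L} {y : L}

theorem exists_eq_smul_add (h : IsDiagonalSplit a y) (z : L) :
    ∃ c : F, ∃ u ∈ a, z = c • y + u := by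
  have hz : z ∈ Submodule.span F {y} ⊔ a.toSubmodule := h.sup_eq_top ▸ Submodule.mem_top
  obtain ⟨z₁, h₁, u, hu, rfl⟩ := Submodule.mem_sup.1 hz
  obtain ⟨c, rfl⟩ := Submodule.mem_span_singleton.1 h₁
  exact ⟨c, u, hu, rfl⟩

theorem lie_mem (h : IsDiagonalSplit a y) (z z' : L) : ⁅z, z'⁆ ∈ a := by
  obtain ⟨c, u, hu, rfl⟩ := h.exists_eq_smul_add z
  obtain ⟨c', u', hu', rfl⟩ := h.exists_eq_smul_add z'
  simp only [add_lie, lie_add, smul_lie, lie_smul, lie_self, smul_zero, zero_add]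
  refine a.add_mem (a.smul_mem _ (lie_mem_left F L a u y hu)) (a.add_mem ?_ ?_)
  · exact a.smul_mem _ (lie_mem_right F L a y u' hu')
  · exact lie_mem_left F L a u u' hu

theorem isSolvable (h : IsDiagonalSplit a y) : LieAlgebra.IsSolvable L := by
  refine LieAlgebra.IsSolvable.mk (R := F) (k := 2) ?_
  have h₁ : LieAlgebra.derivedSeries F L 1 ≤ a := by
    simp only [LieAlgebra.derivedSeriesOfIdeal_succ,
      LieAlgebra.derivedSeriesOfIdeal_zero]
    exact (LieSubmodule.lie_le_iff _ _ _).2 fun z _ z' _ => h.lie_mem z z'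
  have h₂ : LieAlgebra.derivedSeries F L 2 ≤ ⁅a, a⁆ := by
    rw [LieAlgebra.derivedSeries_def, LieAlgebra.derivedSeriesOfIdeal_succ]
    exact LieSubmodule.mono_lie h₁ h₁
  rw [eq_bot_iff]
  refine h₂.trans ((LieSubmodule.lie_le_iff _ _ _).2 fun u hu v hv => ?_)
  simpa using h.abelian u hu v hv

theorem nilpotentRadical_eq (h : IsDiagonalSplit a y) :
    nilpotentRadical F L = ⁅(⊤ : LieIdeal F L), (⊤ : LieIdeal F L)⁆ := by
  have := h.isSolvable
  rw [nilpotentRadical, LieAlgebra.radical_eq_top_of_isSolvable]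

theorem mem_nilpotentRadical (h : IsDiagonalSplit a y) {δ : F} (hδ : δ ≠ 0) {u : L}
    (hu : u ∈ adEigenspace a y δ) : u ∈ nilpotentRadical F L := by
  rw [h.nilpotentRadical_eq, ← inv_smul_smul₀ hδ u, ← hu.2]
  exact (⁅(⊤ : LieIdeal F L), (⊤ : LieIdeal F L)⁆).smul_mem _
    (LieSubmodule.lie_mem_lie (LieSubmodule.mem_top _) (LieSubmodule.mem_top _))

/-- `[L, L]` is spanned by the eigenvectors of `ad y` in `a` with non-zero eigenvalue. -/
theorem nilpotentRadical_le (h : IsDiagonalSplit a y) {P : Submodule F L}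
    (hP : ∀ δ : F, δ ≠ 0 → adEigenspace a y δ ≤ P) :
    (nilpotentRadical F L).toSubmodule ≤ P := by
  have key : ∀ u ∈ a, ⁅y, u⁆ ∈ P := by
    intro u hu
    have hu' : u ∈ ⨆ δ : F, adEigenspace a y δ := h.diagonal ▸ hu
    clear hu
    induction hu' using Submodule.iSup_induction' with
    | mem δ w hw =>
      rw [hw.2]
      by_cases hδ : δ = 0
      · simp [hδ]
      · exact P.smul_mem _ (hP δ hδ hw)
    | zero => simp
    | add w w' hw hw' ih ih' =>
      rw [lie_add]
      exact P.add_mem ih ih'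
  rw [h.nilpotentRadical_eq, LieSubmodule.lieIdeal_oper_eq_linear_span', Submodule.span_le]
  rintro _ ⟨z, -, z', -, rfl⟩
  obtain ⟨c, u, hu, rfl⟩ := h.exists_eq_smul_add z
  obtain ⟨c', u', hu', rfl⟩ := h.exists_eq_smul_add z'
  simp only [add_lie, lie_add, smul_lie, lie_smul, lie_self, smul_zero, zero_add,
    h.abelian u hu u' hu', add_zero]
  rw [← lie_skew]
  exact P.add_mem (P.smul_mem _ (P.neg_mem (key u hu))) (P.smul_mem _ (key u' hu'))

theorem lie_comm_of_mem {U : Type*} [AddCommGroup U] [LieRingModule L U]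
    (h : IsDiagonalSplit a y) {u u' : L} (hu : u ∈ a) (hu' : u' ∈ a) (w : U) :
    ⁅u, ⁅u', w⁆⁆ = ⁅u', ⁅u, w⁆⁆ := by
  rw [leibniz_lie u u' w, h.abelian u hu u' hu', zero_lie, zero_add]

variable {U : Type*} [AddCommGroup U] [Module F U] [LieRingModule L U] [LieModule F L U]

/-- A subspace stable under `y` and under the eigenvectors of `ad y` in `a` is a submodule. -/
theorem lie_mem_of_stable (h : IsDiagonalSplit a y) {P : Submodule F U}
    (hy : ∀ w ∈ P, ⁅y, w⁆ ∈ P) (ha : ∀ δ : F, ∀ u ∈ adEigenspace a y δ, ∀ w ∈ P, ⁅u, w⁆ ∈ P)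
    (z : L) {w : U} (hw : w ∈ P) : ⁅z, w⁆ ∈ P := by
  obtain ⟨c, u, hu, rfl⟩ := h.exists_eq_smul_add z
  have hu' : u ∈ ⨆ δ : F, adEigenspace a y δ := h.diagonal ▸ hu
  rw [add_lie, smul_lie]
  refine P.add_mem (P.smul_mem _ (hy w hw)) ?_
  clear hu
  induction hu' using Submodule.iSup_induction' with
  | mem δ u hu => exact ha δ u hu w hw
  | zero => simp
  | add u u' hu hu' ih ih' =>
    rw [add_lie]
    exact P.add_mem ih ih'

theorem mem_nilpotencySeries_succ (h : IsDiagonalSplit a y) {i : ℕ} {w : U} :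
    w ∈ nilpotencySeries F L U (i + 1) ↔
      ∀ δ : F, δ ≠ 0 → ∀ u ∈ adEigenspace a y δ, ⁅u, w⁆ ∈ nilpotencySeries F L U i := by
  refine ⟨fun hw δ hδ u hu => hw u (h.mem_nilpotentRadical hδ hu), fun hw v hv => ?_⟩
  let P : Submodule F L :=
    (nilpotencySeries F L U i).toSubmodule.comap
      ((LieModule.toEnd F L U : L →ₗ[F] Module.End F U).flip w)
  exact h.nilpotentRadical_le (P := P) (fun δ hδ u hu => hw δ hδ u hu) hv

end IsDiagonalSplit
end SplitExtension

/-! ### The nilpotency series -/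

section Series

variable {F : Type*} [Field F] {L : Type*} [LieRing L] [LieAlgebra F L]
variable {U : Type*} [AddCommGroup U] [Module F U] [LieRingModule L U] [LieModule F L U]

theorem nilpotencySeries_mono : Monotone (nilpotencySeries F L U) :=
  monotone_nat_of_le_succ fun i _ hw v _ => (nilpotencySeries F L U i).lie_mem hw (x := v)

theorem HasNilpotencyLength.ne_succ {m : ℕ} (hm : HasNilpotencyLength F L U m) {i : ℕ}
    (hi : i < m) : nilpotencySeries F L U i ≠ nilpotencySeries F L U (i + 1) := by
  intro heq
  have key : ∀ k, nilpotencySeries F L U (i + k) = nilpotencySeries F L U i := by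
    intro k
    induction k with
    | zero => rfl
    | succ k ih =>
      exact (congrArg nextTerm ih).trans heq.symm
  have h₁ := key (m - i)
  rw [Nat.add_sub_cancel' hi.le, hm.1] at h₁
  exact absurd (hm.2 i h₁.symm) (by omega)

/-- Submodules between `N` and `N'` are comparable if `N' / N` is uniserial. -/
theorem IsUniserialLie.le_or_le_of_factor {N N' : LieSubmodule F L U}
    (h : IsUniserialLie F L (N' ⧸ N.comap N'.incl)) {P Q : LieSubmodule F L U}
    (hP : N ≤ P) (hQ : N ≤ Q) (hP' : P ≤ N') (hQ' : Q ≤ N') : P ≤ Q ∨ Q ≤ P := by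
  have key : ∀ P Q : LieSubmodule F L U, P ≤ N' → N ≤ Q →
      (P.comap N'.incl).map (LieSubmodule.Quotient.mk' (N.comap N'.incl)) ≤
        (Q.comap N'.incl).map (LieSubmodule.Quotient.mk' (N.comap N'.incl)) → P ≤ Q := by
    intro P Q hP' hQ hle w hw
    have h₁ : LieSubmodule.Quotient.mk' (N.comap N'.incl) ⟨w, hP' hw⟩ ∈
        (P.comap N'.incl).map (LieSubmodule.Quotient.mk' (N.comap N'.incl)) :=
      LieSubmodule.mem_map_of_mem (f := LieSubmodule.Quotient.mk' (N.comap N'.incl))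
        (show _ ∈ P.comap N'.incl from hw)
    obtain ⟨w', hw', heq⟩ := LieSubmodule.mem_map _ |>.1 (hle h₁)
    have h₂ : w' - ⟨w, hP' hw⟩ ∈ (N.comap N'.incl).toSubmodule :=
      (Submodule.Quotient.eq _).1 heq
    have h₃ : (w' : U) - w ∈ N := h₂
    have h₄ : (w' : U) ∈ Q := hw'
    have h₅ := Q.sub_mem h₄ (hQ h₃)
    rwa [sub_sub_cancel] at h₅
  exact (h _ _).imp (key P Q hP' hQ) (key Q P hQ' hP)

/-- Some eigenvector of `ad y` with non-zero eigenvalue maps a given factor injectively to the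
previous one. -/
theorem IsDiagonalSplit.exists_injective_step [FiniteDimensional F U] {a : LieIdeal F L} {y : L}
    (h : IsDiagonalSplit a y) {i : ℕ} (hi : IsUniserialLie F L (NilpotencyFactor F L U (i + 1))) :
    ∃ δ : F, δ ≠ 0 ∧ ∃ v ∈ adEigenspace a y δ, ∀ w ∈ nilpotencySeries F L U (i + 2),
      ⁅v, w⁆ ∈ nilpotencySeries F L U i → w ∈ nilpotencySeries F L U (i + 1) := by
  classical
  -- The kernels of the maps induced on the factor by eigenvectors form a chain of submodules whose
  -- intersection is trivial, so a smallest one among them is trivial.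
  let K : {q : F × L // q.1 ≠ 0 ∧ q.2 ∈ adEigenspace a y q.1} → LieSubmodule F L U := fun q =>
    { (nilpotencySeries F L U (i + 2)).toSubmodule ⊓
        (nilpotencySeries F L U i).toSubmodule.comap (LieModule.toEnd F L U q.1.2) with
      lie_mem := by
        rintro z w ⟨hw₁, hw₂⟩
        refine ⟨(nilpotencySeries F L U (i + 2)).lie_mem hw₁, ?_⟩
        replace hw₂ : ⁅q.1.2, w⁆ ∈ nilpotencySeries F L U i := hw₂
        change ⁅q.1.2, ⁅z, w⁆⁆ ∈ nilpotencySeries F L U i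
        have := h.lie_mem_of_stable
          (P := (nilpotencySeries F L U i).toSubmodule.comap (LieModule.toEnd F L U q.1.2))
          (fun w hw => ?_) (fun δ u hu w hw => ?_) z hw₂
        · exact this
        · replace hw : ⁅q.1.2, w⁆ ∈ nilpotencySeries F L U i := hw
          change ⁅q.1.2, ⁅y, w⁆⁆ ∈ nilpotencySeries F L U i
          rw [leibniz_lie, ← lie_skew, q.2.2.2, neg_lie, smul_lie]
          exact add_mem (neg_mem ((nilpotencySeries F L U i).smul_mem _ hw))
            ((nilpotencySeries F L U i).lie_mem hw)
        · change ⁅q.1.2, ⁅u, w⁆⁆ ∈ nilpotencySeries F L U i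
          rw [h.lie_comm_of_mem q.2.2.1 hu.1]
          exact (nilpotencySeries F L U i).lie_mem hw }
  have hK : ∀ q w, w ∈ K q ↔ w ∈ nilpotencySeries F L U (i + 2) ∧
      ⁅q.1.2, w⁆ ∈ nilpotencySeries F L U i := fun q w => Iff.rfl
  have : Nonempty {q : F × L // q.1 ≠ 0 ∧ q.2 ∈ adEigenspace a y q.1} :=
    ⟨⟨(1, 0), one_ne_zero, zero_mem _⟩⟩
  obtain ⟨q, hq⟩ : ∃ q, ∀ q', Module.finrank F (K q).toSubmodule ≤
      Module.finrank F (K q').toSubmodule := by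
    obtain ⟨q, hq⟩ := WellFounded.has_min (InvImage.wf
      (fun q => Module.finrank F (K q).toSubmodule) wellFounded_lt) Set.univ Set.univ_nonempty
    exact ⟨q, fun q' => not_lt.1 (hq.2 q' trivial)⟩
  have hle : ∀ q, nilpotencySeries F L U (i + 1) ≤ K q := fun q w hw =>
    ⟨nilpotencySeries_mono (Nat.le_succ _) hw, h.mem_nilpotencySeries_succ.1 hw _ q.2.1 _ q.2.2⟩
  refine ⟨q.1.1, q.2.1, q.1.2, q.2.2, fun w hw hvw => ?_⟩
  refine h.mem_nilpotencySeries_succ.2 fun δ hδ u hu => ?_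
  have hmin : K q ≤ K ⟨(δ, u), hδ, hu⟩ := by
    rcases hi.le_or_le_of_factor (hle q) (hle ⟨(δ, u), hδ, hu⟩) (fun w hw => hw.1)
      (fun w hw => hw.1) with h₁ | h₁
    · exact h₁
    · have := Submodule.eq_of_le_of_finrank_le (LieSubmodule.toSubmodule_le_toSubmodule _ _ |>.2 h₁)
        (hq ⟨(δ, u), hδ, hu⟩)
      exact (LieSubmodule.toSubmodule_injective this).symm.le
  exact (hmin ((hK q w).2 ⟨hw, hvw⟩)).2

/-- Some eigenvector of `ad y` with non-zero eigenvalue maps every nilpotency factor injectively to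
the previous one. A vector that does so at the first step does so at all steps: compose with one
that is injective at the next step, and use that the two commute. -/
theorem IsDiagonalSplit.exists_injective [FiniteDimensional F U] {a : LieIdeal F L} {y : L}
    (h : IsDiagonalSplit a y) (hU : ∀ i, IsUniserialLie F L (NilpotencyFactor F L U i)) :
    ∃ δ : F, δ ≠ 0 ∧ ∃ v ∈ adEigenspace a y δ, ∀ i, ∀ w ∈ nilpotencySeries F L U (i + 2),
      ⁅v, w⁆ ∈ nilpotencySeries F L U i → w ∈ nilpotencySeries F L U (i + 1) := by
  obtain ⟨δ, hδ, v, hv, hinj⟩ := h.exists_injective_step (hU 1)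
  refine ⟨δ, hδ, v, hv, fun i => ?_⟩
  induction i with
  | zero => exact hinj
  | succ i ih =>
    obtain ⟨γ, hγ, u, hu, huinj⟩ := h.exists_injective_step (hU (i + 2))
    intro w hw hvw
    refine huinj w hw (ih _ (h.mem_nilpotencySeries_succ.1 hw γ hγ u hu) ?_)
    rw [h.lie_comm_of_mem hv.1 hu.1]
    exact h.mem_nilpotencySeries_succ.1 hvw γ hγ u hu

end Series

/-! ### Generic generators of uniserial algebras and uniserial modules over `F[X]` -/

section CommutativeAlgebra

variable {F : Type*} [Field F]

theorem exists_notMem_of_finite [Infinite F] {E : Type*} [AddCommGroup E] [Module F E]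
    {ι : Type*} [Finite ι] (H : ι → Submodule F E) (hH : ∀ i, H i ≠ ⊤) : ∃ e, ∀ i, e ∉ H i := by
  classical
  have := Fintype.ofFinite ι
  by_contra! hcon
  refine Subspace.biUnion_ne_univ_of_top_notMem (s := Finset.univ.image H) (by simpa using hH) ?_
  ext e
  simpa using hcon e

theorem isLocalRing_of_dvd_total {A : Type*} [CommRing A] [Nontrivial A]
    (hdvd : ∀ a b : A, a ∣ b ∨ b ∣ a) : IsLocalRing A := by
  refine IsLocalRing.of_nonunits_add fun a b ha hb hab => ?_
  rcases hdvd a b with h | h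
  · exact ha (isUnit_of_dvd_unit ((dvd_add_right (dvd_refl a)).2 h) hab)
  · exact hb (isUnit_of_dvd_unit ((dvd_add_left (dvd_refl b)).2 h) hab)

variable {A : Type*} [CommRing A] [Algebra F A]

/-- If `b` generates the residue field and some polynomial in `b` lies in `M` but not in `M ^ 2`,
then this polynomial in `b` generates the ideal `M`, and `b` generates the algebra. -/
theorem adjoin_eq_top_of_residue [IsLocalRing A] (hdvd : ∀ a b : A, a ∣ b ∨ b ∣ a)
    (hnil : IsNilpotent (IsLocalRing.maximalIdeal A)) {B : Subalgebra F A}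
    (hB : ∀ a : A, ∃ b ∈ B, a - b ∈ IsLocalRing.maximalIdeal A) {c : A} (hc : c ∈ B)
    (hcM : c ∈ IsLocalRing.maximalIdeal A)
    (hcM2 : IsLocalRing.maximalIdeal A = ⊥ ∨ c ∉ IsLocalRing.maximalIdeal A ^ 2) : B = ⊤ := by
  have hgen : ∀ a ∈ IsLocalRing.maximalIdeal A, ∃ r, a = c * r := by
    intro a ha
    rcases hcM2 with h | h
    · rw [h] at ha
      exact ⟨0, by rw [mul_zero]; exact ha⟩
    rcases hdvd c a with ⟨r, hr⟩ | ⟨r, hr⟩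
    · exact ⟨r, hr⟩
    · have hru : IsUnit r := by
        by_contra hr'
        exact h (by rw [hr, pow_two]; exact Ideal.mul_mem_mul ha hr')
      obtain ⟨s, hs⟩ := hru.exists_right_inv
      exact ⟨s, by rw [hr, mul_assoc, hs, mul_one]⟩
  have key : ∀ n : ℕ, ∀ a : A, ∃ b ∈ B, ∃ r, a = b + c ^ n * r := by
    intro n
    induction n with
    | zero => exact fun a => ⟨0, B.zero_mem, a, by simp⟩
    | succ n ih =>
      intro a
      obtain ⟨b, hb, r, rfl⟩ := ih a
      obtain ⟨b', hb', hM⟩ := hB r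
      obtain ⟨r', hr'⟩ := hgen _ hM
      refine ⟨b + c ^ n * b', B.add_mem hb (B.mul_mem (B.pow_mem hc n) hb'), r', ?_⟩
      rw [pow_succ, mul_assoc, ← hr']
      ring
  obtain ⟨n, hn⟩ := hnil
  have hcn : c ^ n = 0 := by
    have := Ideal.pow_mem_pow hcM n
    rwa [hn] at this
  refine eq_top_iff.2 fun a _ => ?_
  obtain ⟨b, hb, r, rfl⟩ := key n a
  simpa [hcn] using hb

/-- Over an infinite perfect field, a generic element of a generating subspace of a local uniserial
algebra generates the algebra. With `σ` a section of the residue map `π`, it has to avoid the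
subspaces on which two embeddings of the residue field agree, so that `π b` is a primitive element,
and the kernel of the derivation `a ↦ a - σ (π a)` into `A / M ^ 2`, so that the minimal polynomial
of `π b` takes at `b` a value that generates `M`. -/
theorem exists_adjoin_singleton_eq_top [Infinite F] [PerfectField F] [Nontrivial A]
    [Module.Finite F A] (hdvd : ∀ a b : A, a ∣ b ∨ b ∣ a) {E : Type*} [AddCommGroup E] [Module F E]
    (ρ : E →ₗ[F] A) (hρ : Algebra.adjoin F (Set.range ρ) = ⊤) {H : Submodule F E} (hH : H ≠ ⊤) :
    ∃ e ∉ H, Algebra.adjoin F {ρ e} = ⊤ := by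
  classical
  have hloc := isLocalRing_of_dvd_total hdvd
  have : IsArtinianRing A := IsArtinianRing.of_finite F A
  let M := IsLocalRing.maximalIdeal A
  have hnil : IsNilpotent M := by
    have := IsArtinianRing.isNilpotent_jacobson_bot (R := A)
    rwa [IsLocalRing.jacobson_eq_maximalIdeal ⊥ bot_ne_top] at this
  let K := A ⧸ M
  let : Field K := Ideal.Quotient.field M
  let π : A →ₐ[F] K := Ideal.Quotient.mkₐ F M
  have : Module.Finite F K := Module.Finite.of_surjective π.toLinearMap Ideal.Quotient.mk_surjective
  obtain ⟨σ, hσ⟩ := Algebra.FormallySmooth.exists_lift (R := F) (A := K) M hnil (AlgHom.id F K)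
  have hπσ : ∀ k, π (σ k) = k := fun k => DFunLike.congr_fun hσ k
  have hπM : ∀ a, π a = 0 ↔ a ∈ M := fun a => Ideal.Quotient.eq_zero_iff_mem
  -- the derivation
  let D : A →ₗ[F] A ⧸ M ^ 2 := (Ideal.Quotient.mkₐ F (M ^ 2)).toLinearMap ∘ₗ
    (LinearMap.id - (σ.comp π).toLinearMap)
  have hD : ∀ a, D a = 0 ↔ a - σ (π a) ∈ M ^ 2 := fun a => Ideal.Quotient.eq_zero_iff_mem
  have hDρ : M ≠ ⊥ → LinearMap.ker (D ∘ₗ ρ) ≠ ⊤ := by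
    intro hM htop
    have hall : ∀ a : A, D a = 0 := by
      intro a
      have ha : a ∈ Algebra.adjoin F (Set.range ρ) := hρ ▸ Algebra.mem_top
      induction ha using Algebra.adjoin_induction with
      | mem a ha =>
        obtain ⟨e, rfl⟩ := ha
        exact (Submodule.eq_top_iff'.1 htop e : e ∈ LinearMap.ker (D ∘ₗ ρ))
      | algebraMap r => rw [hD]; simp
      | add a b _ _ ha hb => rw [map_add, ha, hb, add_zero]
      | mul a b _ _ ha hb =>
        rw [hD] at ha hb ⊢
        have : a * b - σ (π (a * b)) = (a - σ (π a)) * b + σ (π a) * (b - σ (π b)) := by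
          simp only [map_mul]; ring
        rw [this]
        exact add_mem (Ideal.mul_mem_right _ _ ha) (Ideal.mul_mem_left _ _ hb)
    have hle : M ≤ M ^ 2 := by
      intro a ha
      have := (hD a).1 (hall a)
      rwa [(hπM a).2 ha, map_zero, sub_zero] at this
    obtain ⟨n, hn⟩ := hnil
    have : ∀ k, M ≤ M ^ (k + 1) := by
      intro k
      induction k with
      | zero => simp
      | succ k ih =>
        calc M ≤ M ^ 2 := hle
          _ = M * M := pow_two M
          _ ≤ M ^ (k + 1) * M := Ideal.mul_mono_left ih
          _ = M ^ (k + 1 + 1) := (pow_succ _ _).symm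
    apply hM
    rw [eq_bot_iff]
    refine (this n).trans ((Ideal.pow_le_pow_right (Nat.le_succ n)).trans ?_)
    rw [hn]; exact le_rfl
  -- the subspaces to be avoided
  let Ω := AlgebraicClosure F
  let hyp : Option (Option {q : (K →ₐ[F] Ω) × (K →ₐ[F] Ω) // q.1 ≠ q.2}) → Submodule F E
    | none => H
    | some none => if M = ⊥ then H else LinearMap.ker (D ∘ₗ ρ)
    | some (some q) => LinearMap.ker
        ((q.1.1.toLinearMap - q.1.2.toLinearMap) ∘ₗ π.toLinearMap ∘ₗ ρ)
  obtain ⟨e, he⟩ := exists_notMem_of_finite hyp (by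
    rintro (_ | _ | ⟨q, hq⟩)
    · exact hH
    · change (if M = ⊥ then H else LinearMap.ker (D ∘ₗ ρ)) ≠ ⊤
      split_ifs with h
      · exact hH
      · exact hDρ h
    · intro htop
      apply hq
      have hcomp : q.1.comp π = q.2.comp π := by
        refine AlgHom.ext_of_adjoin_eq_top hρ ?_
        rintro _ ⟨e, rfl⟩
        have h₁ : e ∈ LinearMap.ker ((q.1.toLinearMap - q.2.toLinearMap) ∘ₗ π.toLinearMap ∘ₗ ρ) :=
          (Submodule.eq_top_iff'.1 htop e)
        exact sub_eq_zero.1 h₁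
      ext k
      rw [← hπσ k]
      exact DFunLike.congr_fun hcomp (σ k))
  refine ⟨e, he none, ?_⟩
  set b := ρ e with hb
  have hprim : IntermediateField.adjoin F {π b} = ⊤ := by
    have τ : K →ₐ[F] Ω := IsAlgClosed.lift
    refine (Field.primitive_element_iff_algHom_eq_of_eval F Ω
      (fun x => IsAlgClosed.splits _) (π b) τ).2 fun ψ hψ => ?_
    by_contra hne
    exact he (some (some ⟨(τ, ψ), hne⟩)) (sub_eq_zero.2 hψ)
  have hadj : Algebra.adjoin F {π b} = ⊤ := by
    have := IntermediateField.adjoin_simple_toSubalgebra_of_isAlgebraic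
      (Algebra.IsAlgebraic.isAlgebraic (R := F) (π b))
    rw [← this, hprim, IntermediateField.top_toSubalgebra]
  let p := minpoly F (π b)
  have hpb : π (aeval b p) = 0 := by
    rw [← aeval_algHom_apply, minpoly.aeval]
  refine adjoin_eq_top_of_residue hdvd hnil (c := aeval b p) (fun a => ?_)
    (Polynomial.aeval_mem_adjoin_singleton F b) ((hπM _).1 hpb) ?_
  · have hk : π a ∈ Algebra.adjoin F {π b} := hadj ▸ Algebra.mem_top
    rw [Algebra.adjoin_singleton_eq_range_aeval] at hk
    obtain ⟨f, hf⟩ := hk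
    refine ⟨aeval b f, Polynomial.aeval_mem_adjoin_singleton F b, (hπM _).1 ?_⟩
    rw [map_sub, ← aeval_algHom_apply, sub_eq_zero]
    exact hf.symm
  · by_cases hM : M = ⊥
    · exact Or.inl hM
    refine Or.inr fun hmem => ?_
    have hDb : b - σ (π b) ∉ M ^ 2 := by
      have := he (some none)
      change e ∉ (if M = ⊥ then H else LinearMap.ker (D ∘ₗ ρ)) at this
      rw [if_neg hM] at this
      exact fun h => this ((hD b).2 h)
    -- modulo `M ^ 2`, the value `p(b)` is `p'(σ (π b)) (b - σ (π b))`, and `p'(σ (π b))` is a unit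
    obtain ⟨k, hk⟩ := Polynomial.binomExpansion (p.map (algebraMap F A)) (σ (π b)) (b - σ (π b))
    rw [add_sub_cancel, derivative_map, eval_map_algebraMap, eval_map_algebraMap,
      eval_map_algebraMap] at hk
    have h0 : aeval (σ (π b)) p = 0 := by
      rw [aeval_algHom_apply, minpoly.aeval, map_zero]
    rw [h0, zero_add] at hk
    have hMb : b - σ (π b) ∈ M := by
      rw [← hπM, map_sub, hπσ, sub_self]
    have hsq : (aeval (σ (π b)) (derivative p)) * (b - σ (π b)) ∈ M ^ 2 := by
      have : k * (b - σ (π b)) ^ 2 ∈ M ^ 2 :=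
        Ideal.mul_mem_left _ _ (Ideal.pow_mem_pow hMb 2)
      rw [eq_sub_of_add_eq hk.symm]
      exact sub_mem hmem this
    have hunit : IsUnit (aeval (σ (π b)) (derivative p)) := by
      rw [aeval_algHom_apply]
      refine IsUnit.map σ (isUnit_iff_ne_zero.2 ?_)
      exact (Algebra.IsSeparable.isSeparable F (π b)).aeval_derivative_ne_zero (minpoly.aeval _ _)
    obtain ⟨r, hr⟩ := hunit.exists_left_inv
    apply hDb
    have := Ideal.mul_mem_left _ r hsq
    rwa [← mul_assoc, hr, one_mul] at this

/-- A Noetherian uniserial module is cyclic. -/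
theorem exists_span_singleton_eq_top {R V : Type*} [Ring R] [AddCommGroup V] [Module R V]
    [IsNoetherian R V] (h : ∀ P Q : Submodule R V, P ≤ Q ∨ Q ≤ P) :
    ∃ w : V, Submodule.span R {w} = ⊤ := by
  obtain ⟨_, ⟨w, rfl⟩, hmax⟩ := WellFounded.has_min
    (wellFounded_gt : WellFounded ((· > ·) : Submodule R V → Submodule R V → Prop))
    (Set.range fun w => Submodule.span R {w}) ⟨_, ⟨0, rfl⟩⟩
  refine ⟨w, eq_top_iff.2 fun w' _ => ?_⟩
  have hw' : Submodule.span R {w'} ≤ Submodule.span R {w} :=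
    (h _ _).elim id fun h₁ => not_lt_iff_le_imp_ge.1 (hmax _ ⟨w', rfl⟩) h₁
  exact hw' (Submodule.mem_span_singleton_self w')

/-- A commutative ring with a faithful Noetherian uniserial module is itself uniserial. -/
theorem dvd_total_of_uniserial {R V : Type*} [CommRing R] [AddCommGroup V] [Module R V]
    [FaithfulSMul R V] [IsNoetherian R V] (h : ∀ P Q : Submodule R V, P ≤ Q ∨ Q ≤ P) (r r' : R) :
    r ∣ r' ∨ r' ∣ r := by
  obtain ⟨w, hw⟩ := exists_span_singleton_eq_top h
  have hfaith : ∀ r r' : R, r • w = r' • w → r = r' := by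
    intro r r' heq
    refine FaithfulSMul.eq_of_smul_eq_smul (α := V) fun w' => ?_
    obtain ⟨q, rfl⟩ := Submodule.mem_span_singleton.1 (hw ▸ Submodule.mem_top : w' ∈ _)
    rw [smul_comm, heq, smul_comm]
  have key : ∀ r r' : R, Submodule.span R {r • w} ≤ Submodule.span R {r' • w} → r' ∣ r := by
    intro r r' hle
    obtain ⟨q, hq⟩ := Submodule.mem_span_singleton.1 (hle (Submodule.mem_span_singleton_self _))
    exact ⟨q, hfaith _ _ (by rw [← hq, mul_comm, mul_smul])⟩
  exact ((h _ _).imp (key r r') (key r' r)).symm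

open scoped IsMulCommutative in
/-- If commuting operators, depending linearly on `e ∈ E`, have only a chain of common invariant
subspaces, then all invariant subspaces of a generic one among them are common: the algebra that
they generate is local and uniserial, and the generic operator generates it. -/
theorem exists_generic_operator [Infinite F] [PerfectField F] {V : Type*} [AddCommGroup V]
    [Module F V] [FiniteDimensional F V] [Nontrivial V] {E : Type*} [AddCommGroup E] [Module F E]
    (ρ : E →ₗ[F] Module.End F V) (hcomm : ∀ e e', ρ e * ρ e' = ρ e' * ρ e)
    (hchain : ∀ P Q : Submodule F V, (∀ e, ∀ w ∈ P, ρ e w ∈ P) → (∀ e, ∀ w ∈ Q, ρ e w ∈ Q) →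
      P ≤ Q ∨ Q ≤ P) {H : Submodule F E} (hH : H ≠ ⊤) :
    ∃ e ∉ H, ∀ P : Submodule F V, (∀ w ∈ P, ρ e w ∈ P) → ∀ e', ∀ w ∈ P, ρ e' w ∈ P := by
  have : IsMulCommutative (Algebra.adjoin F (Set.range ρ)) := Algebra.isMulCommutative_adjoin F (by
    rintro _ ⟨e, rfl⟩ _ ⟨e', rfl⟩
    exact hcomm e e')
  have hρA : ∀ e, ρ e ∈ Algebra.adjoin F (Set.range ρ) := fun e => Algebra.subset_adjoin ⟨e, rfl⟩
  generalize hA : Algebra.adjoin F (Set.range ρ) = A at *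
  have : IsNoetherian A V := isNoetherian_of_tower F inferInstance
  have hdvd : ∀ r r' : A, r ∣ r' ∨ r' ∣ r := dvd_total_of_uniserial (V := V) fun P Q =>
    (hchain (P.restrictScalars F) (Q.restrictScalars F)
      (fun e w hw => P.smul_mem ⟨ρ e, hρA e⟩ hw) (fun e w hw => Q.smul_mem ⟨ρ e, hρA e⟩ hw))
  have hfd : Module.Finite F A := Module.Finite.of_injective A.val.toLinearMap
    Subtype.val_injective
  let ρ' : E →ₗ[F] A := LinearMap.codRestrict A.toSubmodule ρ hρA
  have htop : Algebra.adjoin F (Set.range ρ') = ⊤ := by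
    apply Subalgebra.map_injective (f := A.val) Subtype.val_injective
    rw [AlgHom.map_adjoin, Algebra.map_top, Subalgebra.range_val, ← Set.range_comp]
    exact hA
  obtain ⟨e, heH, he⟩ := exists_adjoin_singleton_eq_top hdvd ρ' htop hH
  refine ⟨e, heH, fun P hP e' w hw => ?_⟩
  have he' : ρ' e' ∈ Algebra.adjoin F {ρ' e} := he ▸ Algebra.mem_top
  have key : ∀ r ∈ Algebra.adjoin F {ρ' e}, ∀ w ∈ P, (r : Module.End F V) w ∈ P := by
    intro r hr
    induction hr using Algebra.adjoin_induction with
    | mem r hr => rw [Set.mem_singleton_iff.1 hr]; exact hP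
    | algebraMap c => exact fun w hw => P.smul_mem c hw
    | add r r' _ _ h h' => exact fun w hw => P.add_mem (h w hw) (h' w hw)
    | mul r r' _ _ h h' => exact fun w hw => h _ (h' w hw)
  exact key _ he' w hw

/-- A non-zero finitely generated uniserial torsion `F[X]`-module is isomorphic to
`F[X] / (p ^ s)` with `p` irreducible: it is cyclic, and a polynomial whose divisors modulo it
form a chain has only one prime factor. -/
theorem IsUniserialPoly.exists_equiv {M : Type*} [AddCommGroup M] [Module F[X] M]
    [Module.Finite F[X] M] [Nontrivial M] (h : IsUniserialPoly F M)
    (htor : ∀ w : M, ∃ f : F[X], f ≠ 0 ∧ f • w = 0) :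
    ∃ (p : F[X]) (s : ℕ), p.Monic ∧ Irreducible p ∧ 1 ≤ s ∧
      Nonempty (M ≃ₗ[F[X]] (F[X] ⧸ Ideal.span {p ^ s})) := by
  obtain ⟨w, hw⟩ := exists_span_singleton_eq_top h
  obtain ⟨f, hf⟩ := Submodule.IsPrincipal.principal (Ideal.torsionOf F[X] M w)
  have hfw : ∀ g : F[X], g • w = 0 ↔ f ∣ g := fun g => by
    rw [← Ideal.mem_torsionOf_iff, hf]
    exact Ideal.mem_span_singleton
  have hf0 : f ≠ 0 := by
    rintro rfl
    obtain ⟨f, hf, hfw'⟩ := htor w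
    exact hf (zero_dvd_iff.1 ((hfw f).1 hfw'))
  have hfu : ¬ IsUnit f := by
    intro hu
    have h₁ : w = 0 := by simpa using (hfw 1).2 hu.dvd
    rw [h₁, Submodule.span_zero_singleton] at hw
    exact bot_ne_top hw
  have hspan : ∀ g g' : F[X], Submodule.span F[X] {g • w} ≤ Submodule.span F[X] {g' • w} →
      ∃ q, f ∣ g - q * g' := by
    intro g g' hle
    obtain ⟨q, hq⟩ := Submodule.mem_span_singleton.1 (hle (Submodule.mem_span_singleton_self _))
    exact ⟨q, (hfw _).1 (by rw [sub_smul, mul_smul, hq, sub_self])⟩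
  obtain ⟨p, hpm, hpi, hpf⟩ := Polynomial.exists_monic_irreducible_factor f hfu
  obtain ⟨q, hfq, hpq⟩ :=
    (FiniteMultiplicity.of_prime_left hpi.prime hf0).exists_eq_pow_mul_and_not_dvd
  generalize multiplicity p f = s at hfq
  have hs : 1 ≤ s := by
    rcases Nat.eq_zero_or_pos s with rfl | hs
    · rw [pow_zero, one_mul] at hfq
      exact absurd (hfq ▸ hpf) hpq
    · exact hs
  have hcop : IsCoprime (p ^ s) q := ((hpi.coprime_iff_not_dvd).2 hpq).pow_left
  have hqu : IsUnit q := by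
    rcases h (Submodule.span F[X] {p ^ s • w}) (Submodule.span F[X] {q • w}) with h₁ | h₁
    · obtain ⟨r, hr⟩ := hspan _ _ h₁
      have h₂ : q ∣ p ^ s :=
        (dvd_sub_left (dvd_mul_left q r)).1 ((hfq ▸ dvd_mul_left q _ : q ∣ f).trans hr)
      exact hcop.symm.isUnit_of_dvd h₂
    · obtain ⟨r, hr⟩ := hspan _ _ h₁
      have h₂ : p ^ s ∣ q :=
        (dvd_sub_left (dvd_mul_left _ r)).1 ((hfq ▸ dvd_mul_right _ q : p ^ s ∣ f).trans hr)
      exact absurd ((dvd_pow_self p (by omega)).trans h₂) hpq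
  have hideal : Ideal.torsionOf F[X] M w = Ideal.span {p ^ s} := by
    rw [hf]
    refine (Ideal.span_singleton_eq_span_singleton.2 ?_)
    obtain ⟨c, rfl⟩ := hqu
    exact ⟨c⁻¹, by rw [hfq, mul_assoc, Units.mul_inv, mul_one]⟩
  refine ⟨p, s, hpm, hpi, hs, ⟨?_⟩⟩
  exact ((Submodule.quotEquivOfEq _ _ hideal).symm.trans
    ((Ideal.quotTorsionOfEquivSpanSingleton F[X] M w).trans
      ((LinearEquiv.ofEq _ _ hw).trans Submodule.topEquiv))).symm

end CommutativeAlgebra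

/-! ### Nilpotency factors as `F[X]`-modules -/

section Factors

variable {F : Type*} [Field F] {L : Type*} [LieRing L] [LieAlgebra F L]
variable {U : Type*} [AddCommGroup U] [Module F U] [LieRingModule L U] [LieModule F L U]

theorem aeval_mem_of_forall_mem {P : Submodule F U} {Y : Module.End F U} (hP : ∀ w ∈ P, Y w ∈ P)
    (g : F[X]) {w : U} (hw : w ∈ P) : aeval Y g w ∈ P := by
  induction g using Polynomial.induction_on' generalizing w with
  | add g g' h h' => rw [map_add]; exact P.add_mem (h hw) (h' hw)
  | monomial n c =>
    rw [aeval_monomial, Module.algebraMap_end_eq_smul_id, Module.End.mul_apply]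
    refine P.smul_mem c ?_
    induction n with
    | zero => exact hw
    | succ n ih => rw [pow_succ', Module.End.mul_apply]; exact hP _ ih

theorem aeval_toEnd_mem_lieSubmodule (N : LieSubmodule F L U) (y : L) (g : F[X]) {w : U}
    (hw : w ∈ N) : aeval (LieModule.toEnd F L U y) g w ∈ N :=
  aeval_mem_of_forall_mem (P := N.toSubmodule) (fun _ h => N.lie_mem h) g hw

/-- If `Y u = u Y + δ u`, then `g(Y) u = u g(Y + δ)`. -/
theorem aeval_apply_of_lie_eq_smul {y u : L} {δ : F} (hu : ⁅y, u⁆ = δ • u) (g : F[X]) (w : U) :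
    aeval (LieModule.toEnd F L U y) g ⁅u, w⁆ =
      ⁅u, aeval (LieModule.toEnd F L U y) (g.comp (X + C δ)) w⁆ := by
  have hstep : ∀ w : U, ⁅y, ⁅u, w⁆⁆ =
      ⁅u, aeval (LieModule.toEnd F L U y) (X + C δ : F[X]) w⁆ := by
    intro w
    rw [leibniz_lie, hu, map_add, aeval_X, aeval_C, LinearMap.add_apply,
      Module.algebraMap_end_apply, lie_add, lie_smul, smul_lie, LieModule.toEnd_apply_apply,
      add_comm]
  induction g using Polynomial.induction_on' generalizing w with
  | add g g' h h' =>
    rw [add_comp, map_add, map_add, LinearMap.add_apply, LinearMap.add_apply, h, h', lie_add]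
  | monomial n c =>
    rw [← C_mul_X_pow_eq_monomial, mul_comp, C_comp, X_pow_comp, map_mul, map_mul, aeval_C,
      Module.End.mul_apply, Module.End.mul_apply, Module.algebraMap_end_apply,
      Module.algebraMap_end_apply, lie_smul]
    congr 1
    induction n generalizing w with
    | zero => simp
    | succ n ih =>
      rw [pow_succ, map_mul, Module.End.mul_apply, aeval_X, LieModule.toEnd_apply_apply, hstep,
        ih, pow_succ, map_mul, Module.End.mul_apply]

variable (F) in
/-- The class in `U^(i+1) / U^(i)`, as an `F[X]`-module via `y`, of a vector of `U^(i+1)`. -/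
noncomputable def factorClass (y : L) (i : ℕ) (w : nilpotencySeries F L U (i + 1)) :
    FactorVia F U y i :=
  Module.AEval'.of (LieModule.toEnd F L (NilpotencyFactor F L U i) y) (Submodule.Quotient.mk w)

theorem factorClass_surjective (y : L) (i : ℕ) :
    Function.Surjective (factorClass F (U := U) y i) :=
  (Module.AEval'.of _).surjective.comp (Submodule.mkQ_surjective _)

theorem factorClass_add (y : L) (i : ℕ) (w w' : nilpotencySeries F L U (i + 1)) :
    factorClass F y i (w + w') = factorClass F y i w + factorClass F y i w' := rfl

theorem factorClass_sub (y : L) (i : ℕ) (w w' : nilpotencySeries F L U (i + 1)) :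
    factorClass F y i (w - w') = factorClass F y i w - factorClass F y i w' := rfl

theorem factorClass_eq_zero {y : L} {i : ℕ} {w : nilpotencySeries F L U (i + 1)} :
    factorClass F y i w = 0 ↔ (w : U) ∈ nilpotencySeries F L U i :=
  LieSubmodule.Quotient.mk_eq_zero'

theorem X_smul_factorClass (y : L) (i : ℕ) (w : nilpotencySeries F L U (i + 1)) :
    (X : F[X]) • factorClass F y i w = factorClass F y i ⁅y, w⁆ :=
  Module.AEval'.X_smul_of _ _

theorem C_smul_factorClass (y : L) (i : ℕ) (c : F) (w : nilpotencySeries F L U (i + 1)) :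
    (C c : F[X]) • factorClass F y i w = factorClass F y i (c • w) :=
  Module.AEval.C_smul _ _ _

theorem smul_factorClass {y : L} {i : ℕ} (g : F[X]) {w : U}
    (hw : w ∈ nilpotencySeries F L U (i + 1)) :
    g • factorClass F y i ⟨w, hw⟩ = factorClass F y i
      ⟨aeval (LieModule.toEnd F L U y) g w, aeval_toEnd_mem_lieSubmodule _ y g hw⟩ := by
  induction g using Polynomial.induction_on' generalizing w with
  | add g g' h h' =>
    rw [add_smul, h, h', ← factorClass_add]
    congr 1
    exact Subtype.ext (by simp)
  | monomial n c =>
    induction n generalizing w c with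
    | zero =>
      rw [monomial_zero_left, C_smul_factorClass]
      congr 1
      exact Subtype.ext (by simp)
    | succ n ih =>
      rw [← monomial_mul_X, mul_smul, X_smul_factorClass]
      refine (ih c (w := ⁅y, w⁆) ((nilpotencySeries F L U (i + 1)).lie_mem hw)).trans ?_
      congr 1
      exact Subtype.ext (by simp [pow_succ])

/-- `e` generates the nilpotency factor `U^(i+1) / U^(i)` as an `F[X]`-module with `X` acting
as `y`, and its annihilator is generated by `f`. -/
structure IsFactorGenerator (y : L) (i : ℕ) (f : F[X]) (e : U) : Prop where
  mem : e ∈ nilpotencySeries F L U (i + 1)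
  aeval_mem_iff : ∀ g : F[X],
    aeval (LieModule.toEnd F L U y) g e ∈ nilpotencySeries F L U i ↔ f ∣ g
  exists_sub_mem : ∀ w ∈ nilpotencySeries F L U (i + 1), ∃ g : F[X],
    w - aeval (LieModule.toEnd F L U y) g e ∈ nilpotencySeries F L U i

theorem exists_isFactorGenerator {y : L} {i : ℕ} {f : F[X]}
    (φ : FactorVia F U y i ≃ₗ[F[X]] (F[X] ⧸ Ideal.span {f})) :
    ∃ e : U, IsFactorGenerator y i f e := by
  obtain ⟨⟨e, he⟩, heφ⟩ := factorClass_surjective y i (φ.symm 1)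
  have hφ : ∀ g : F[X], φ (g • factorClass F y i ⟨e, he⟩) = Ideal.Quotient.mk _ g := by
    intro g
    rw [heφ, map_smul, LinearEquiv.apply_symm_apply]
    change Ideal.Quotient.mk _ (g * 1) = _
    rw [mul_one]
  refine ⟨e, he, fun g => ?_, fun w hw => ?_⟩
  · rw [← Ideal.mem_span_singleton, ← Ideal.Quotient.eq_zero_iff_mem, ← hφ,
      LinearEquiv.map_eq_zero_iff, smul_factorClass, factorClass_eq_zero]
  · obtain ⟨g, hg⟩ := Ideal.Quotient.mk_surjective (φ (factorClass F y i ⟨w, hw⟩))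
    refine ⟨g, ?_⟩
    rw [← hφ, smul_factorClass] at hg
    have h₁ := sub_eq_zero.2 (φ.injective hg).symm
    rw [← factorClass_sub, factorClass_eq_zero] at h₁
    exact h₁

/-- A uniserial factor is uniserial as an `F[X]`-module via `y` if its `y`-stable subspaces are
submodules. -/
theorem isUniserialPoly_factorVia {y : L} {i : ℕ}
    (hi : IsUniserialLie F L (NilpotencyFactor F L U i))
    (h : ∀ P : Submodule F U, (nilpotencySeries F L U i).toSubmodule ≤ P →
      P ≤ (nilpotencySeries F L U (i + 1)).toSubmodule → (∀ w ∈ P, ⁅y, w⁆ ∈ P) →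
      ∀ z : L, ∀ w ∈ P, ⁅z, w⁆ ∈ P) :
    IsUniserialPoly F (FactorVia F U y i) := by
  let P : Submodule F[X] (FactorVia F U y i) → Submodule F U := fun S =>
    Submodule.map (nilpotencySeries F L U (i + 1)).toSubmodule.subtype
      { carrier := {w | factorClass F y i w ∈ S}
        zero_mem' := S.zero_mem
        add_mem' := fun h h' => S.add_mem h h'
        smul_mem' := fun c w h => by
          change factorClass F y i (c • w) ∈ S
          rw [← C_smul_factorClass]
          exact S.smul_mem _ h }
  have hP : ∀ S (w : nilpotencySeries F L U (i + 1)), (w : U) ∈ P S ↔ factorClass F y i w ∈ S :=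
    fun S w => ⟨fun ⟨w', h₁, h₂⟩ => (Subtype.ext h₂ : w' = w) ▸ h₁, fun hw => ⟨w, hw, rfl⟩⟩
  have hle : ∀ S, P S ≤ (nilpotencySeries F L U (i + 1)).toSubmodule := by
    rintro S _ ⟨w, -, rfl⟩
    exact w.2
  have hge : ∀ S, (nilpotencySeries F L U i).toSubmodule ≤ P S := by
    intro S w hw
    refine (hP S ⟨w, nilpotencySeries_mono (Nat.le_succ i) hw⟩).2 ?_
    rw [factorClass_eq_zero.2 hw]
    exact S.zero_mem
  have hy : ∀ S, ∀ w ∈ P S, ⁅y, w⁆ ∈ P S := by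
    rintro S _ ⟨w, hw, rfl⟩
    refine (hP S ⁅y, w⁆).2 ?_
    rw [← X_smul_factorClass]
    exact S.smul_mem _ hw
  let Q : Submodule F[X] (FactorVia F U y i) → LieSubmodule F L U := fun S =>
    { P S with lie_mem := fun {z w} hw => h (P S) (hge S) (hle S) (hy S) z w hw }
  have key : ∀ S S', Q S ≤ Q S' → S ≤ S' := by
    intro S S' hSS w hw
    obtain ⟨w, rfl⟩ := factorClass_surjective y i w
    exact (hP S' w).1 (hSS ((hP S w).2 hw))
  intro S S'
  exact (hi.le_or_le_of_factor (hge S) (hge S') (hle S) (hle S')).imp (key S S') (key S' S)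

end Factors

/-! ### Changing `y` by an element of `a_0` -/

section Generic

variable {F : Type*} [Field F] {L : Type*} [LieRing L] [LieAlgebra F L]
variable {U : Type*} [AddCommGroup U] [Module F U] [LieRingModule L U] [LieModule F L U]
variable {a : LieIdeal F L}

theorem adEigenspace_smul_add {x w₀ : L} (hab : ∀ u ∈ a, ∀ v ∈ a, ⁅u, v⁆ = 0)
    (hw₀ : w₀ ∈ a) {α : F} (hα : α ≠ 0) (δ : F) :
    adEigenspace a (α • x + w₀) (α * δ) = adEigenspace a x δ := by
  ext u
  refine and_congr_right fun hu => ?_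
  rw [add_lie, hab w₀ hw₀ u hu, add_zero, smul_lie, mul_smul]
  exact (smul_right_injective L hα).eq_iff

theorem IsDiagonalSplit.smul_add {x w₀ : L} (h : IsDiagonalSplit a x) (hw₀ : w₀ ∈ a) {α : F}
    (hα : α ≠ 0) : IsDiagonalSplit a (α • x + w₀) where
  sup_eq_top := by
    refine eq_top_iff.2 fun z _ => ?_
    obtain ⟨c, u, hu, rfl⟩ := h.exists_eq_smul_add z
    refine Submodule.mem_sup.2 ⟨(c * α⁻¹) • (α • x + w₀),
      Submodule.smul_mem _ _ (Submodule.mem_span_singleton_self _), u - (c * α⁻¹) • w₀,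
      a.sub_mem hu (a.smul_mem _ hw₀), ?_⟩
    rw [_root_.smul_add, smul_smul, mul_assoc, inv_mul_cancel₀ hα, mul_one]
    abel
  abelian := h.abelian
  diagonal := by
    rw [← h.diagonal]
    refine le_antisymm (iSup_le fun δ => ?_) (iSup_le fun δ => ?_)
    · have := adEigenspace_smul_add (x := x) h.abelian hw₀ hα (α⁻¹ * δ)
      rw [← mul_assoc, mul_inv_cancel₀ hα, one_mul] at this
      rw [this]
      exact le_iSup (adEigenspace a x) _
    · rw [← adEigenspace_smul_add (x := x) h.abelian hw₀ hα δ]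
      exact le_iSup (adEigenspace a (α • x + w₀)) _

/-- As `n` annihilates the nilpotency factors, only `y` and `a(0)` decide which subspaces of a
factor are submodules. -/
theorem IsDiagonalSplit.lie_mem_of_stable_of_le {y : L} (h : IsDiagonalSplit a y) {i : ℕ}
    {P : Submodule F U} (hP : (nilpotencySeries F L U i).toSubmodule ≤ P)
    (hP' : P ≤ (nilpotencySeries F L U (i + 1)).toSubmodule) (hy : ∀ w ∈ P, ⁅y, w⁆ ∈ P)
    (h0 : ∀ u ∈ adEigenspace a y 0, ∀ w ∈ P, ⁅u, w⁆ ∈ P) (z : L) {w : U} (hw : w ∈ P) :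
    ⁅z, w⁆ ∈ P := by
  refine h.lie_mem_of_stable hy (fun δ u hu w hw => ?_) z hw
  by_cases hδ : δ = 0
  · exact h0 u (hδ ▸ hu) w hw
  · exact hP (h.mem_nilpotencySeries_succ.1 (hP' hw) δ hδ u hu)

/-- If the `y`-stable subspaces of `U^(1)` are stable under `a(0)`, then so are the `y`-stable
subspaces of all nilpotency factors, since `v` embeds each factor into the previous one. -/
theorem IsDiagonalSplit.lie_mem_of_stable_of_injective {y v : L} {δ : F} (h : IsDiagonalSplit a y)
    (hδ : δ ≠ 0) (hv : v ∈ adEigenspace a y δ)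
    (hinj : ∀ i, ∀ w ∈ nilpotencySeries F L U (i + 2),
      ⁅v, w⁆ ∈ nilpotencySeries F L U i → w ∈ nilpotencySeries F L U (i + 1))
    (h1 : ∀ P : Submodule F U, P ≤ (nilpotencySeries F L U 1).toSubmodule →
      (∀ w ∈ P, ⁅y, w⁆ ∈ P) → ∀ u ∈ adEigenspace a y 0, ∀ w ∈ P, ⁅u, w⁆ ∈ P)
    (i : ℕ) {P : Submodule F U} (hP : (nilpotencySeries F L U i).toSubmodule ≤ P)
    (hP' : P ≤ (nilpotencySeries F L U (i + 1)).toSubmodule) (hy : ∀ w ∈ P, ⁅y, w⁆ ∈ P) :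
    ∀ u ∈ adEigenspace a y 0, ∀ w ∈ P, ⁅u, w⁆ ∈ P := by
  induction i generalizing P with
  | zero => exact h1 P hP' hy
  | succ i ih =>
    intro u hu w hw
    let Q : Submodule F U :=
      P.map (LieModule.toEnd F L U v) ⊔ (nilpotencySeries F L U i).toSubmodule
    have hmem : ∀ w ∈ P, ⁅v, w⁆ ∈ Q := fun w hw =>
      Submodule.mem_sup_left ⟨w, hw, rfl⟩
    have hQ : Q ≤ (nilpotencySeries F L U (i + 1)).toSubmodule := by
      refine sup_le ?_ (nilpotencySeries_mono (Nat.le_succ i))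
      rintro _ ⟨w, hw, rfl⟩
      exact h.mem_nilpotencySeries_succ.1 (hP' hw) δ hδ v hv
    have hyQ : ∀ w ∈ Q, ⁅y, w⁆ ∈ Q := by
      intro w hw
      obtain ⟨_, ⟨w₁, hw₁, rfl⟩, w₂, hw₂, rfl⟩ := Submodule.mem_sup.1 hw
      rw [lie_add]
      refine Q.add_mem ?_ (Submodule.mem_sup_right ((nilpotencySeries F L U i).lie_mem hw₂))
      rw [LieModule.toEnd_apply_apply, leibniz_lie, hv.2, smul_lie]
      exact Q.add_mem (Q.smul_mem _ (hmem _ hw₁)) (hmem _ (hy _ hw₁))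
    have h₁ := ih le_sup_right hQ hyQ u hu _ (hmem w hw)
    obtain ⟨_, ⟨w', hw', rfl⟩, n, hn, heq⟩ := Submodule.mem_sup.1 h₁
    have h₂ : ⁅u, w⁆ - w' ∈ nilpotencySeries F L U (i + 1) := by
      refine hinj i _ (sub_mem ((nilpotencySeries F L U (i + 2)).lie_mem (hP' hw)) (hP' hw')) ?_
      rw [lie_sub, ← h.lie_comm_of_mem hu.1 hv.1, ← heq, LieModule.toEnd_apply_apply,
        add_sub_cancel_left]
      exact hn
    have := P.add_mem (hP h₂) hw'
    rwa [sub_add_cancel] at this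

/-- Over an infinite perfect field, some multiple of `x` can be modified by an element of `a(0)` so
that the subspaces of `U^(1)` stable under it are submodules. -/
theorem IsDiagonalSplit.exists_generic [Infinite F] [PerfectField F] [FiniteDimensional F U]
    {x : L} (h : IsDiagonalSplit a x) (hx : x ∉ a) [Nontrivial (nilpotencySeries F L U 1)]
    (hU : IsUniserialLie F L (NilpotencyFactor F L U 0)) :
    ∃ w₀ ∈ adEigenspace a x 0, ∀ P : Submodule F U, P ≤ (nilpotencySeries F L U 1).toSubmodule →
      (∀ w ∈ P, ⁅x + w₀, w⁆ ∈ P) → ∀ z : L, ∀ w ∈ P, ⁅z, w⁆ ∈ P := by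
  have hkill : ∀ n ∈ nilpotentRadical F L, ∀ w ∈ nilpotencySeries F L U 1, ⁅n, w⁆ = 0 :=
    fun n hn w hw => hw n hn
  -- avoiding `a` makes the coefficient of `x` in the generic element non-zero
  obtain ⟨e, he, heP⟩ := exists_generic_operator (H := a.toSubmodule)
    (LieModule.toEnd F L (nilpotencySeries F L U 1) :
      L →ₗ[F] Module.End F (nilpotencySeries F L U 1))
    (fun z z' => by
      refine LinearMap.ext fun w => Subtype.ext ?_
      change ⁅z, ⁅z', (w : U)⁆⁆ = ⁅z', ⁅z, (w : U)⁆⁆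
      rw [leibniz_lie, hkill ⁅z, z'⁆ ?_ w w.2, zero_add]
      rw [h.nilpotentRadical_eq]
      exact LieSubmodule.lie_mem_lie (LieSubmodule.mem_top _) (LieSubmodule.mem_top _))
    (fun P Q hP hQ => by
      let T : ∀ P : Submodule F (nilpotencySeries F L U 1),
          (∀ (z : L), ∀ w ∈ P, LieModule.toEnd F L (nilpotencySeries F L U 1) z w ∈ P) →
          LieSubmodule F L U := fun P hP =>
        { P.map (nilpotencySeries F L U 1).toSubmodule.subtype with
          lie_mem := by
            rintro z _ ⟨w, hw, rfl⟩
            exact ⟨_, hP z w hw, rfl⟩ }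
      have hT : ∀ P hP, T P hP ≤ nilpotencySeries F L U 1 := by
        rintro P hP _ ⟨w, -, rfl⟩
        exact w.2
      have hTle : ∀ P hP Q hQ, T P hP ≤ T Q hQ → P ≤ Q := by
        intro P hP Q hQ hle w hw
        obtain ⟨w', hw', heq⟩ := hle (show (w : U) ∈ T P hP from ⟨w, hw, rfl⟩)
        exact (Subtype.ext heq : w' = w) ▸ hw'
      exact (hU.le_or_le_of_factor (P := T P hP) (Q := T Q hQ) bot_le bot_le (hT P hP)
        (hT Q hQ)).imp (hTle P hP Q hQ) (hTle Q hQ P hP))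
    (fun htop => hx (by
      have : x ∈ a.toSubmodule := htop ▸ Submodule.mem_top
      exact this))
  obtain ⟨c, u, hu, rfl⟩ := h.exists_eq_smul_add e
  have hc : c ≠ 0 := by
    rintro rfl
    exact he (by simpa using hu)
  obtain ⟨u₀, hu₀, n, hn, rfl⟩ : ∃ u₀ ∈ adEigenspace a x 0, ∃ n ∈ nilpotentRadical F L,
      u = u₀ + n := by
    have hu' : u ∈ ⨆ δ : F, adEigenspace a x δ := h.diagonal ▸ hu
    have hle : ⨆ δ : F, adEigenspace a x δ ≤
        adEigenspace a x 0 ⊔ (nilpotentRadical F L).toSubmodule := by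
      refine iSup_le fun δ => ?_
      by_cases hδ : δ = 0
      · rw [hδ]; exact le_sup_left
      · exact le_sup_of_le_right fun v hv => h.mem_nilpotentRadical hδ hv
    obtain ⟨u₀, h₀, n, hn, rfl⟩ := Submodule.mem_sup.1 (hle hu')
    exact ⟨u₀, h₀, n, hn, rfl⟩
  refine ⟨c⁻¹ • u₀, Submodule.smul_mem _ _ hu₀, fun P hP hy z w hw => ?_⟩
  refine heP (P.comap (nilpotencySeries F L U 1).toSubmodule.subtype) (fun w hw => ?_) z
    ⟨w, hP hw⟩ hw
  change ⁅c • x + (u₀ + n), (w : U)⁆ ∈ P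
  have h₁ : ⁅c • x + (u₀ + n), (w : U)⁆ = c • ⁅x + c⁻¹ • u₀, (w : U)⁆ := by
    rw [add_lie, add_lie, add_lie, hkill n hn w w.2, smul_lie, smul_lie, _root_.smul_add,
      smul_smul, mul_inv_cancel₀ hc, one_smul, add_zero]
  rw [h₁]
  exact P.smul_mem _ (hy _ hw)

/-- `v` shifts the eigenvalues of `y` by `δ` and embeds each factor into the previous one, so the
elementary divisors of consecutive factors are related by `X ↦ X + δ`. -/
theorem IsFactorGenerator.shift {y v : L} {δ : F} (hv : ⁅y, v⁆ = δ • v) {i : ℕ} {p p' : F[X]}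
    {s s' : ℕ} {e e' : U} (he : IsFactorGenerator y i (p ^ s) e)
    (he' : IsFactorGenerator y (i + 1) (p' ^ s') e')
    (hlow : ∀ w ∈ nilpotencySeries F L U (i + 2), ⁅v, w⁆ ∈ nilpotencySeries F L U (i + 1))
    (hinj : ∀ w ∈ nilpotencySeries F L U (i + 2),
      ⁅v, w⁆ ∈ nilpotencySeries F L U i → w ∈ nilpotencySeries F L U (i + 1))
    (hp : p.Monic) (hpi : Irreducible p) (hp' : p'.Monic) (hpi' : Irreducible p') (hs' : 1 ≤ s') :
    p' = p.comp (X + C δ) ∧ s' ≤ s := by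
  have hdvd : p' ^ s' ∣ (p.comp (X + C δ)) ^ s := by
    rw [← pow_comp, ← he'.aeval_mem_iff]
    refine hinj _ (aeval_toEnd_mem_lieSubmodule _ y _ he'.mem) ?_
    rw [← aeval_apply_of_lie_eq_smul hv]
    obtain ⟨g, hg⟩ := he.exists_sub_mem _ (hlow _ he'.mem)
    have h₁ := aeval_toEnd_mem_lieSubmodule _ y (p ^ s) hg
    rw [map_sub, ← Module.End.mul_apply, ← map_mul] at h₁
    have h₂ := (he.aeval_mem_iff (p ^ s * g)).2 (dvd_mul_right _ _)
    have h₃ := add_mem h₁ h₂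
    rwa [sub_add_cancel] at h₃
  have hcomp := irreducible_comp_X_add_C hpi δ
  have hcompm : (p.comp (X + C δ)).Monic := hp.comp_X_add_C δ
  have heq : p' = p.comp (X + C δ) := by
    have h₁ : p' ∣ p.comp (X + C δ) :=
      hpi'.prime.dvd_of_dvd_pow ((dvd_pow_self p' (by omega)).trans hdvd)
    exact eq_of_monic_of_associated hp' hcompm (hpi'.associated_of_dvd hcomp h₁)
  refine ⟨heq, ?_⟩
  rw [← heq] at hdvd
  exact (pow_dvd_pow_iff hpi'.ne_zero hpi'.not_isUnit).1 hdvd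

end Generic

/-! ### Existence of adapted data -/

section Existence

variable {F : Type*} [Field F] {L : Type*} [LieRing L] [LieAlgebra F L]
variable {U : Type*} [AddCommGroup U] [Module F U] [LieRingModule L U] [LieModule F L U]
variable {a : LieIdeal F L}

theorem exists_equiv_factorVia [FiniteDimensional F U] {y : L} {i : ℕ}
    (hne : nilpotencySeries F L U i ≠ nilpotencySeries F L U (i + 1))
    (h : IsUniserialPoly F (FactorVia F U y i)) :
    ∃ (p : F[X]) (s : ℕ), p.Monic ∧ Irreducible p ∧ 1 ≤ s ∧
      Nonempty (FactorVia F U y i ≃ₗ[F[X]] (F[X] ⧸ Ideal.span {p ^ s})) := by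
  have hnt : Nontrivial (FactorVia F U y i) := by
    obtain ⟨w, hw, hw'⟩ := SetLike.exists_of_lt
      (lt_of_le_of_ne (nilpotencySeries_mono (Nat.le_succ i)) hne)
    exact ⟨factorClass F y i ⟨w, hw⟩, 0, fun h0 => hw' (factorClass_eq_zero.1 h0)⟩
  refine h.exists_equiv fun w => ?_
  obtain ⟨⟨w, hw⟩, rfl⟩ := factorClass_surjective y i w
  refine ⟨minpoly F (LieModule.toEnd F L U y),
    minpoly.ne_zero (Algebra.IsIntegral.isIntegral _), ?_⟩
  rw [smul_factorClass]
  refine factorClass_eq_zero.2 ?_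
  simp

/-- Existence of the data `y`, `p_i`, `s_i`. Scaling `x` normalizes the eigenvalue of `v` to `1`,
and a generic `w₀ ∈ a_0` (or `w₀ = 0`, if `a_0 = 0`) makes the factors uniserial via
`y = δ⁻¹ x + w₀`. -/
theorem IsDiagonalSplit.exists_isAdapted [FiniteDimensional F U] {x : L} (h : IsDiagonalSplit a x)
    (hx : x ∉ a) (hF : (Infinite F ∧ PerfectField F) ∨ adEigenspace a x 0 = ⊥)
    (hU : IsLinked F L U) {m : ℕ} (hlen : HasNilpotencyLength F L U m) (hm : 1 < m) :
    ∃ (y : L) (d : ℕ) (p : Fin m → F[X]) (s : Fin m → ℕ), IsAdapted a x U hm y d p s := by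
  obtain ⟨δ, hδ, v, hv, hinj⟩ := h.exists_injective hU.2
  obtain ⟨w₀, hw₀, hstab⟩ : ∃ w₀ ∈ adEigenspace a x 0, ∀ P : Submodule F U,
      P ≤ (nilpotencySeries F L U 1).toSubmodule → (∀ w ∈ P, ⁅δ⁻¹ • x + w₀, w⁆ ∈ P) →
      ∀ u ∈ adEigenspace a x 0, ∀ w ∈ P, ⁅u, w⁆ ∈ P := by
    rcases hF with ⟨_, _⟩ | h0
    · have : Nontrivial (nilpotencySeries F L U 1) := by
        obtain ⟨w, hw, hw'⟩ := SetLike.exists_of_lt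
          (lt_of_le_of_ne (nilpotencySeries_mono (Nat.le_succ 0)) (hlen.ne_succ (by omega)))
        exact ⟨⟨w, hw⟩, 0, fun h0 => hw' (congrArg Subtype.val h0)⟩
      obtain ⟨w₁, hw₁, hgen⟩ := h.exists_generic hx (hU.2 0)
      refine ⟨δ⁻¹ • w₁, Submodule.smul_mem _ _ hw₁, fun P hP hy u _ w hw =>
        hgen P hP (fun w hw => ?_) u w hw⟩
      have := P.smul_mem δ (hy w hw)
      rwa [← _root_.smul_add, smul_lie, smul_inv_smul₀ hδ] at this
    · refine ⟨0, zero_mem _, fun P _ _ u hu w _ => ?_⟩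
      rw [h0, Submodule.mem_bot] at hu
      rw [hu, zero_lie]
      exact P.zero_mem
  have hα : δ⁻¹ ≠ 0 := inv_ne_zero hδ
  have hy : IsDiagonalSplit a (δ⁻¹ • x + w₀) := h.smul_add hw₀.1 hα
  have hv' : v ∈ adEigenspace a (δ⁻¹ • x + w₀) 1 := by
    rw [← inv_mul_cancel₀ hδ, adEigenspace_smul_add h.abelian hw₀.1 hα]
    exact hv
  have h0 : adEigenspace a (δ⁻¹ • x + w₀) 0 = adEigenspace a x 0 := by
    have := adEigenspace_smul_add (x := x) h.abelian hw₀.1 hα 0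
    rwa [mul_zero] at this
  have huni : ∀ i, IsUniserialPoly F (FactorVia F U (δ⁻¹ • x + w₀) i) := fun i =>
    isUniserialPoly_factorVia (hU.2 i) fun P hP hP' hyP z w hw =>
      hy.lie_mem_of_stable_of_le hP hP' hyP
        (hy.lie_mem_of_stable_of_injective one_ne_zero hv' hinj (h0 ▸ hstab) i hP hP' hyP) z hw
  choose p s hmonic hirr hpos hiso using fun i : Fin m =>
    exists_equiv_factorVia (y := δ⁻¹ • x + w₀) (hlen.ne_succ i.2) (huni i)
  choose e he using fun i => exists_isFactorGenerator (hiso i).some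
  have hshift : ∀ (i : ℕ) (hi : i + 1 < m),
      p ⟨i + 1, hi⟩ = (p ⟨i, by omega⟩).comp (X + C 1) ∧ s ⟨i + 1, hi⟩ ≤ s ⟨i, by omega⟩ :=
    fun i hi => IsFactorGenerator.shift hv'.2 (he ⟨i, by omega⟩) (he ⟨i + 1, hi⟩)
      (fun w hw => hy.mem_nilpotencySeries_succ.1 hw 1 one_ne_zero v hv') (hinj i)
      (hmonic _) (hirr _) (hmonic _) (hirr _) (hpos _)
  have hp : ∀ (i : ℕ) (hi : i < m), p ⟨i, hi⟩ = (p ⟨0, by omega⟩).comp (X + C (i : F)) := by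
    intro i
    induction i with
    | zero => simp
    | succ i ih =>
      intro hi
      rw [(hshift i hi).1, ih (by omega), comp_X_add_C_comp, Nat.cast_succ]
  have hs : ∀ k i (hi : i + k < m), s ⟨i + k, hi⟩ ≤ s ⟨i, by omega⟩ := by
    intro k
    induction k with
    | zero => exact fun i hi => le_rfl
    | succ k ih => exact fun i hi => (hshift (i + k) hi).2.trans (ih i (by omega))
  refine ⟨δ⁻¹ • x + w₀, (p ⟨0, by omega⟩).natDegree, p, s, ?_, fun hmem => ?_, fun i => huni i,
    hmonic, hirr, hpos, hiso, fun i => ?_, fun i => hp i i.2, fun i j hij => ?_⟩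
  · exact Submodule.add_mem_sup
      (Submodule.smul_mem _ _ (Submodule.mem_span_singleton_self x)) hw₀
  · apply hx
    have := a.smul_mem δ (a.sub_mem hmem.1 hw₀.1)
    rwa [add_sub_cancel_right, smul_inv_smul₀ hδ] at this
  · rw [hp i i.2, natDegree_comp, natDegree_X_add_C, mul_one]
  · have hij' : (i : ℕ) ≤ j := hij
    have := hs (j - i) i (by omega)
    simpa only [Nat.add_sub_cancel' hij'] using this

end Existence

/-! ### Generators of the primary components -/

section Structure

variable {F : Type*} [Field F] {L : Type*} [LieRing L] [LieAlgebra F L]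
variable {U : Type*} [AddCommGroup U] [Module F U] [LieRingModule L U] [LieModule F L U]

variable (U) in
/-- The factors of the nilpotency series of `U` are, via `y`, isomorphic to `F[X] / (q_i ^ s_i)`
with `q_i = q(X + i)`, the polynomials `q_0, ..., q_(m-1)` being pairwise distinct, and `v ∈ a(1)`
embeds each factor into the previous one. -/
structure IsShiftSystem (a : LieIdeal F L) (y v : L) (m : ℕ) (q : F[X]) (s : ℕ → ℕ) : Prop where
  split : IsDiagonalSplit a y
  top : nilpotencySeries F L U m = ⊤
  mem : v ∈ adEigenspace a y 1
  injective : ∀ i, ∀ w ∈ nilpotencySeries F L U (i + 2),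
    ⁅v, w⁆ ∈ nilpotencySeries F L U i → w ∈ nilpotencySeries F L U (i + 1)
  monic : q.Monic
  irreducible : Irreducible q
  stabilizer : ∀ γ : F, q.comp (X + C γ) = q → γ = 0
  cast_injective : ∀ i < m, ∀ j < m, (i : F) = (j : F) → i = j
  pos : ∀ i < m, 1 ≤ s i
  le : ∀ i, i + 1 < m → s (i + 1) ≤ s i
  exists_generator : ∀ i < m, ∃ e : U,
    IsFactorGenerator y i (q.comp (X + C (i : F)) ^ s i) e

theorem IsFactorGenerator.of_isCoprime {y : L} {i : ℕ} {f : F[X]} {e : U}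
    (he : IsFactorGenerator y i f e) {g : F[X]} (hg : IsCoprime g f) :
    IsFactorGenerator y i f (aeval (LieModule.toEnd F L U y) g e) := by
  refine ⟨aeval_toEnd_mem_lieSubmodule _ y g he.mem, fun k => ?_, fun w hw => ?_⟩
  · rw [← Module.End.mul_apply, ← map_mul, he.aeval_mem_iff]
    exact ⟨fun h => hg.symm.dvd_of_dvd_mul_right h, fun h => h.mul_right g⟩
  · obtain ⟨k, hk⟩ := he.exists_sub_mem w hw
    obtain ⟨r, t, hrt⟩ := hg
    refine ⟨k * r, ?_⟩
    have h₁ := (he.aeval_mem_iff (k * t * f)).2 (dvd_mul_left _ _)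
    have h₂ := add_mem hk h₁
    have h₃ : k = k * r * g + k * t * f := by linear_combination -k * hrt
    rw [← Module.End.mul_apply, ← map_mul]
    convert h₂ using 1
    nth_rewrite 2 [h₃]
    rw [map_add, LinearMap.add_apply]
    abel

/-- A vector annihilated by coprime polynomials is zero. -/
theorem eq_zero_of_aeval_eq_zero {Y : Module.End F U} {f g : F[X]} (h : IsCoprime f g) {w : U}
    (hf : aeval Y f w = 0) (hg : aeval Y g w = 0) : w = 0 := by
  obtain ⟨r, t, hrt⟩ := h
  have : aeval Y (r * f + t * g) w = 0 := by
    rw [map_add, map_mul, map_mul, LinearMap.add_apply, Module.End.mul_apply,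
      Module.End.mul_apply, hf, hg, map_zero, map_zero, add_zero]
  rwa [hrt, map_one, Module.End.one_apply] at this

theorem aeval_mul_apply (Y : Module.End F U) (f g : F[X]) (w : U) :
    aeval Y (f * g) w = aeval Y f (aeval Y g w) := by
  rw [map_mul, Module.End.mul_apply]

theorem aeval_apply_comm (Y : Module.End F U) (f g : F[X]) (w : U) :
    aeval Y f (aeval Y g w) = aeval Y g (aeval Y f w) := by
  rw [← aeval_mul_apply, ← aeval_mul_apply, mul_comm]

namespace IsShiftSystem

variable {a : LieIdeal F L} {y v : L} {m : ℕ} {q : F[X]} {s : ℕ → ℕ}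

theorem isCoprime (h : IsShiftSystem U a y v m q s) {i : ℕ} {γ : F}
    (hγ : γ ≠ (i : F)) (t t' : ℕ) :
    IsCoprime (q.comp (X + C γ) ^ t) (q.comp (X + C (i : F)) ^ t') :=
  (isCoprime_comp_X_add_C h.irreducible h.monic h.stabilizer hγ).pow

theorem aeval_prod_eq_zero (h : IsShiftSystem U a y v m q s) {n : ℕ} (hn : n ≤ m) {w : U}
    (hw : w ∈ nilpotencySeries F L U n) :
    aeval (LieModule.toEnd F L U y)
      (∏ k ∈ Finset.range n, q.comp (X + C (k : F)) ^ s k) w = 0 := by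
  induction n generalizing w with
  | zero =>
    rw [show w = 0 from hw, map_zero]
  | succ n ih =>
    rw [Finset.prod_range_succ, aeval_mul_apply]
    refine ih (by omega) ?_
    obtain ⟨e, he⟩ := h.exists_generator n hn
    obtain ⟨g, hg⟩ := he.exists_sub_mem w hw
    have h₁ := aeval_toEnd_mem_lieSubmodule _ y (q.comp (X + C (n : F)) ^ s n) hg
    rw [map_sub, ← aeval_mul_apply] at h₁
    have h₂ := add_mem h₁ ((he.aeval_mem_iff (q.comp (X + C (n : F)) ^ s n * g)).2
      (dvd_mul_right _ _))
    rwa [sub_add_cancel] at h₂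

theorem isCoprime_prod (h : IsShiftSystem U a y v m q s) {n : ℕ} (hn : n < m) (t : ℕ) :
    IsCoprime (∏ k ∈ Finset.range n, q.comp (X + C (k : F)) ^ s k)
      (q.comp (X + C (n : F)) ^ t) := by
  refine IsCoprime.prod_left fun k hk => h.isCoprime (fun heq => ?_) _ _
  have hkn := Finset.mem_range.1 hk
  have := h.cast_injective k (by omega) n hn heq
  omega

/-- The generators of the factors can be chosen in the primary components of `y`. -/
theorem exists_primary_generator (h : IsShiftSystem U a y v m q s) {n : ℕ} (hn : n < m) :
    ∃ e : U, IsFactorGenerator y n (q.comp (X + C (n : F)) ^ s n) e ∧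
      aeval (LieModule.toEnd F L U y) (q.comp (X + C (n : F)) ^ s n) e = 0 := by
  obtain ⟨e, he⟩ := h.exists_generator n hn
  refine ⟨_, he.of_isCoprime (h.isCoprime_prod hn (s n)), ?_⟩
  rw [aeval_apply_comm]
  exact h.aeval_prod_eq_zero hn.le ((he.aeval_mem_iff _).2 dvd_rfl)

theorem lie_mem (h : IsShiftSystem U a y v m q s) {n : ℕ} {w : U}
    (hw : w ∈ nilpotencySeries F L U (n + 1)) : ⁅v, w⁆ ∈ nilpotencySeries F L U n :=
  h.split.mem_nilpotencySeries_succ.1 hw 1 one_ne_zero v h.mem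

/-- Given a generator of one factor, a generator of the next one can be chosen so that `v` maps it
to a power of `q_n(y)` applied to the former. -/
theorem exists_next_generator (h : IsShiftSystem U a y v m q s) {n : ℕ} (hn : n + 1 < m) {e : U}
    (he : IsFactorGenerator y n (q.comp (X + C (n : F)) ^ s n) e)
    (he0 : aeval (LieModule.toEnd F L U y) (q.comp (X + C (n : F)) ^ s n) e = 0) :
    ∃ e' : U, IsFactorGenerator y (n + 1)
        (q.comp (X + C ((n + 1 : ℕ) : F)) ^ s (n + 1)) e' ∧
      aeval (LieModule.toEnd F L U y) (q.comp (X + C ((n + 1 : ℕ) : F)) ^ s (n + 1)) e' = 0 ∧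
      ⁅v, e'⁆ = aeval (LieModule.toEnd F L U y)
        (q.comp (X + C (n : F)) ^ (s n - s (n + 1))) e := by
  have hshift : (q.comp (X + C (n : F))).comp (X + C 1) = q.comp (X + C ((n + 1 : ℕ) : F)) := by
    rw [comp_X_add_C_comp, Nat.cast_succ]
  have hpow : ∀ t, (q.comp (X + C (n : F)) ^ t).comp (X + C 1) =
      q.comp (X + C ((n + 1 : ℕ) : F)) ^ t := fun t => by rw [pow_comp, hshift]
  have hv : ⁅y, v⁆ = (1 : F) • v := h.mem.2
  have hirr := irreducible_comp_X_add_C h.irreducible (n : F)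
  have hle := h.le n hn
  obtain ⟨e', he', he0'⟩ := h.exists_primary_generator hn
  set P := q.comp (X + C (n : F)) with hP
  obtain ⟨g, hg⟩ := he.exists_sub_mem _ (h.lie_mem he'.mem)
  have hve0 : aeval (LieModule.toEnd F L U y) (P ^ s (n + 1)) ⁅v, e'⁆ = 0 := by
    rw [aeval_apply_of_lie_eq_smul hv, hpow, he0', lie_zero]
  -- the difference of the two sides is in `U^(n)`, so it is annihilated by coprime polynomials
  have hve : ⁅v, e'⁆ = aeval (LieModule.toEnd F L U y) g e := by
    rw [← sub_eq_zero]
    refine eq_zero_of_aeval_eq_zero (h.isCoprime_prod (by omega : n < m) (s n))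
      (h.aeval_prod_eq_zero (by omega) hg) ?_
    rw [map_sub, aeval_apply_comm, he0, map_zero, sub_zero, ← Nat.sub_add_cancel hle, pow_add,
      aeval_mul_apply, hve0, map_zero]
  have hdvd : P ^ s n ∣ P ^ s (n + 1) * g := by
    rw [← he.aeval_mem_iff, aeval_mul_apply, ← hve, hve0]
    exact zero_mem _
  obtain ⟨k, rfl⟩ : P ^ (s n - s (n + 1)) ∣ g := by
    rw [← Nat.add_sub_cancel' hle, pow_add] at hdvd
    exact (mul_dvd_mul_iff_left (pow_ne_zero _ hirr.ne_zero)).1 hdvd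
  -- `k` is prime to `P`, since `v` is injective on the factor; so `k` can be absorbed in `e'`
  have hPk : ¬ P ∣ k := by
    rintro ⟨l, rfl⟩
    have hpos := h.pos (n + 1) hn
    have h₁ : ⁅v, aeval (LieModule.toEnd F L U y)
        (q.comp (X + C ((n + 1 : ℕ) : F)) ^ (s (n + 1) - 1)) e'⁆ = 0 := by
      rw [← hpow, ← aeval_apply_of_lie_eq_smul hv, hve, ← aeval_mul_apply]
      have : P ^ (s (n + 1) - 1) * (P ^ (s n - s (n + 1)) * (P * l)) = l * P ^ s n := by
        obtain ⟨t, ht⟩ : ∃ t, s n = t + s (n + 1) := ⟨_, (Nat.sub_add_cancel hle).symm⟩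
        obtain ⟨r, hr⟩ : ∃ r, s (n + 1) = r + 1 := ⟨_, (Nat.sub_add_cancel hpos).symm⟩
        rw [ht, hr, Nat.add_sub_cancel, Nat.add_sub_cancel]
        ring
      rw [this, aeval_mul_apply, he0, map_zero]
    have h₂ := h.injective n _ (aeval_toEnd_mem_lieSubmodule _ y _ he'.mem)
      (by rw [h₁]; exact zero_mem _)
    rw [he'.aeval_mem_iff] at h₂
    have h₃ := (pow_dvd_pow_iff
      (irreducible_comp_X_add_C h.irreducible ((n + 1 : ℕ) : F)).ne_zero
      (irreducible_comp_X_add_C h.irreducible ((n + 1 : ℕ) : F)).not_isUnit).1 h₂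
    omega
  have hcop : IsCoprime k (P ^ s n) := ((hirr.coprime_iff_not_dvd).2 hPk).symm.pow_right
  obtain ⟨r, t, hrt⟩ := hcop
  have hcop' : IsCoprime (r.comp (X + C 1)) (q.comp (X + C ((n + 1 : ℕ) : F)) ^ s (n + 1)) := by
    have h₁ : IsCoprime r (P ^ s (n + 1)) :=
      IsCoprime.of_isCoprime_of_dvd_right
        (⟨k, t, by linear_combination hrt⟩ : IsCoprime r (P ^ s n))
        (pow_dvd_pow P hle)
    obtain ⟨b, c, hbc⟩ := h₁
    refine ⟨b.comp (X + C 1), c.comp (X + C 1), ?_⟩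
    rw [← hpow, ← mul_comp, ← mul_comp, ← add_comp, hbc, one_comp]
  refine ⟨_, he'.of_isCoprime hcop', ?_, ?_⟩
  · rw [aeval_apply_comm, he0', map_zero]
  · rw [← aeval_apply_of_lie_eq_smul hv, hve, ← aeval_mul_apply]
    have : r * (P ^ (s n - s (n + 1)) * k) =
        P ^ (s n - s (n + 1)) - P ^ (s n - s (n + 1)) * t * P ^ s n := by
      linear_combination P ^ (s n - s (n + 1)) * hrt
    rw [this, map_sub, LinearMap.sub_apply, aeval_mul_apply _ _ (P ^ s n), he0, map_zero, sub_zero]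

end IsShiftSystem

/-- Generators `e_i` of the primary components of `y`, which map to generators of the nilpotency
factors, with `v e_(i+1) = q_i(y) ^ (s_i - s_(i+1)) e_i`. -/
structure IsGeneratorSystem (y v : L) (m : ℕ) (q : F[X]) (s : ℕ → ℕ) (e : ℕ → U) : Prop where
  generator : ∀ i < m, IsFactorGenerator y i (q.comp (X + C (i : F)) ^ s i) (e i)
  aeval_eq_zero : ∀ i < m,
    aeval (LieModule.toEnd F L U y) (q.comp (X + C (i : F)) ^ s i) (e i) = 0
  lie_succ : ∀ i, i + 1 < m → ⁅v, e (i + 1)⁆ = aeval (LieModule.toEnd F L U y)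
    (q.comp (X + C (i : F)) ^ (s i - s (i + 1))) (e i)

namespace IsShiftSystem

variable {a : LieIdeal F L} {y v : L} {m : ℕ} {q : F[X]} {s : ℕ → ℕ}

theorem exists_isGeneratorSystem (h : IsShiftSystem U a y v m q s) :
    ∃ e : ℕ → U, IsGeneratorSystem y v m q s e := by
  classical
  let G : ℕ → U → Prop := fun i e => i < m →
    IsFactorGenerator y i (q.comp (X + C (i : F)) ^ s i) e ∧
      aeval (LieModule.toEnd F L U y) (q.comp (X + C (i : F)) ^ s i) e = 0
  have h0 : ∃ e, G 0 e := by
    by_cases hm : 0 < m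
    · obtain ⟨e, he⟩ := h.exists_primary_generator hm
      exact ⟨e, fun _ => he⟩
    · exact ⟨0, fun hm' => absurd hm' hm⟩
  have hnext : ∀ i (e : {e // G i e}), ∃ e' : {e' // G (i + 1) e'}, i + 1 < m →
      ⁅v, (e' : U)⁆ = aeval (LieModule.toEnd F L U y)
        (q.comp (X + C (i : F)) ^ (s i - s (i + 1))) (e : U) := by
    rintro i ⟨e, he⟩
    by_cases hm : i + 1 < m
    · obtain ⟨e', h₁, h₂, h₃⟩ := h.exists_next_generator hm (he (by omega)).1 (he (by omega)).2
      exact ⟨⟨e', fun _ => ⟨h₁, h₂⟩⟩, fun _ => h₃⟩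
    · exact ⟨⟨0, fun hm' => absurd hm' hm⟩, fun hm' => absurd hm' hm⟩
  choose next hnext using hnext
  let e : ∀ i, {e // G i e} := fun i => Nat.rec ⟨h0.choose, h0.choose_spec⟩ next i
  exact ⟨fun i => (e i).1, fun i hi => ((e i).2 hi).1, fun i hi => ((e i).2 hi).2,
    fun i => hnext i (e i)⟩

end IsShiftSystem
end Structure

/-! ### Primary components and the shifted operator -/

section Decomposition

variable {F : Type*} [Field F] {L : Type*} [LieRing L] [LieAlgebra F L]
variable {U : Type*} [AddCommGroup U] [Module F U] [LieRingModule L U] [LieModule F L U]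
variable {a : LieIdeal F L} {y v : L} {m : ℕ} {q : F[X]} {s : ℕ → ℕ} {e : ℕ → U}

namespace IsGeneratorSystem

theorem aeval_eq_zero_iff (he : IsGeneratorSystem y v m q s e) {k : ℕ} (hk : k < m) (g : F[X]) :
    aeval (LieModule.toEnd F L U y) g (e k) = 0 ↔ q.comp (X + C (k : F)) ^ s k ∣ g := by
  refine ⟨fun h => ((he.generator k hk).aeval_mem_iff g).1 (h ▸ zero_mem _), ?_⟩
  rintro ⟨g, rfl⟩
  rw [mul_comm, aeval_mul_apply, he.aeval_eq_zero k hk, map_zero]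

theorem aeval_mem (he : IsGeneratorSystem y v m q s e) {k n : ℕ} (hk : k < n) (hn : n ≤ m)
    (g : F[X]) : aeval (LieModule.toEnd F L U y) g (e k) ∈ nilpotencySeries F L U n :=
  aeval_toEnd_mem_lieSubmodule _ y g
    (nilpotencySeries_mono (Nat.succ_le_of_lt hk) (he.generator k (by omega)).mem)

theorem exists_eq_sum (he : IsGeneratorSystem y v m q s e) {n : ℕ} (hn : n ≤ m) {w : U}
    (hw : w ∈ nilpotencySeries F L U n) :
    ∃ g : ℕ → F[X], w = ∑ k ∈ Finset.range n, aeval (LieModule.toEnd F L U y) (g k) (e k) := by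
  classical
  induction n generalizing w with
  | zero => exact ⟨0, by rw [show w = 0 from hw]; simp⟩
  | succ n ih =>
    obtain ⟨f, hf⟩ := (he.generator n (by omega)).exists_sub_mem w hw
    obtain ⟨g, hg⟩ := ih (by omega) hf
    refine ⟨Function.update g n f, ?_⟩
    rw [Finset.sum_range_succ, Function.update_self, ← sub_eq_iff_eq_add, hg]
    refine Finset.sum_congr rfl fun k hk => ?_
    rw [Function.update_of_ne (Finset.mem_range.1 hk).ne]

theorem aeval_eq_zero_of_sum (he : IsGeneratorSystem y v m q s e) {n : ℕ} (hn : n ≤ m)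
    {g : ℕ → F[X]}
    (hg : ∑ k ∈ Finset.range n, aeval (LieModule.toEnd F L U y) (g k) (e k) = 0) {k : ℕ}
    (hk : k < n) : aeval (LieModule.toEnd F L U y) (g k) (e k) = 0 := by
  induction n with
  | zero => omega
  | succ n ih =>
    rw [Finset.sum_range_succ] at hg
    have hmem : ∑ k ∈ Finset.range n, aeval (LieModule.toEnd F L U y) (g k) (e k) ∈
        nilpotencySeries F L U n :=
      sum_mem fun k hk => he.aeval_mem (Finset.mem_range.1 hk) (by omega) _
    have h₁ : aeval (LieModule.toEnd F L U y) (g n) (e n) = 0 := by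
      rw [he.aeval_eq_zero_iff (by omega), ← (he.generator n (by omega)).aeval_mem_iff,
        eq_neg_of_add_eq_zero_right hg]
      exact neg_mem hmem
    rcases Nat.lt_succ_iff_lt_or_eq.1 hk with hk | rfl
    · exact ih (by omega) (by rw [h₁, add_zero] at hg; exact hg) hk
    · exact h₁

end IsGeneratorSystem

/-- `E` acts as `y + k` on the `k`-th primary component of `y`. -/
structure IsShiftedOperator (y : L) (m : ℕ) (e : ℕ → U) (E : Module.End F U) : Prop where
  aeval_apply : ∀ k < m, ∀ f g : F[X],
    aeval E f (aeval (LieModule.toEnd F L U y) g (e k)) =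
      aeval (LieModule.toEnd F L U y) (f.comp (X + C (k : F)) * g) (e k)

namespace IsShiftSystem

/-- A vector annihilated by a power of `q(X + γ)` lies in a single primary component, and this
component is determined by `γ`. -/
theorem eq_zero_or_exists (h : IsShiftSystem U a y v m q s) (he : IsGeneratorSystem y v m q s e)
    {n : ℕ} (hn : n ≤ m) {z : U} (hz : z ∈ nilpotencySeries F L U n) {γ : F} {t : ℕ}
    (hγ : aeval (LieModule.toEnd F L U y) (q.comp (X + C γ) ^ t) z = 0) :
    z = 0 ∨ ∃ k < n, γ = (k : F) ∧
      ∃ g : F[X], z = aeval (LieModule.toEnd F L U y) g (e k) := by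
  obtain ⟨g, rfl⟩ := he.exists_eq_sum hn hz
  have hterm : ∀ k < n, γ ≠ (k : F) → aeval (LieModule.toEnd F L U y) (g k) (e k) = 0 := by
    intro k hk hne
    rw [map_sum] at hγ
    simp only [← aeval_mul_apply] at hγ
    have h₁ := he.aeval_eq_zero_of_sum (g := fun k => q.comp (X + C γ) ^ t * g k) hn hγ hk
    rw [he.aeval_eq_zero_iff (by omega)] at h₁ ⊢
    exact (h.isCoprime hne t (s k)).symm.dvd_of_dvd_mul_left h₁
  by_cases hex : ∃ k < n, γ = (k : F)
  · obtain ⟨k, hk, hγk⟩ := hex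
    refine Or.inr ⟨k, hk, hγk, g k, ?_⟩
    refine Finset.sum_eq_single_of_mem k (Finset.mem_range.2 hk) fun l hl hlk => ?_
    have hl' := Finset.mem_range.1 hl
    refine hterm l hl' fun h' => hlk ?_
    exact h.cast_injective l (by omega) k (by omega) (h'.symm.trans hγk)
  · push Not at hex
    exact Or.inl (Finset.sum_eq_zero fun k hk =>
      hterm k (Finset.mem_range.1 hk) (hex k (Finset.mem_range.1 hk)))

/-- The image of a primary component under `u ∈ a(δ)` is annihilated by a shifted power. -/
theorem aeval_lie_eq_zero (he : IsGeneratorSystem y v m q s e) {k : ℕ} (hk : k < m) {δ : F} {u : L}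
    (hu : u ∈ adEigenspace a y δ) (g : F[X]) :
    aeval (LieModule.toEnd F L U y) (q.comp (X + C ((k : F) - δ)) ^ s k)
      ⁅u, aeval (LieModule.toEnd F L U y) g (e k)⁆ = 0 := by
  rw [aeval_apply_of_lie_eq_smul hu.2, pow_comp, comp_X_add_C_comp, sub_add_cancel,
    aeval_apply_comm, he.aeval_eq_zero k hk, map_zero, lie_zero]

/-- `u ∈ a(δ)` maps the `k`-th primary component to the `l`-th one, where `l = k - δ` in `F`,
and `l < k` unless `δ = 0`. -/
theorem lie_eq_zero_or_exists (h : IsShiftSystem U a y v m q s)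
    (he : IsGeneratorSystem y v m q s e) {k : ℕ} (hk : k < m) {δ : F} {u : L}
    (hu : u ∈ adEigenspace a y δ) (g : F[X]) :
    ⁅u, aeval (LieModule.toEnd F L U y) g (e k)⁆ = 0 ∨ ∃ l < m, (k : F) - δ = (l : F) ∧
      (δ ≠ 0 → l < k) ∧ ∃ f : F[X], ⁅u, aeval (LieModule.toEnd F L U y) g (e k)⁆ =
        aeval (LieModule.toEnd F L U y) f (e l) := by
  have h₁ := aeval_lie_eq_zero he hk hu g
  by_cases hδ : δ = 0
  · rcases h.eq_zero_or_exists he le_rfl (h.top ▸ LieSubmodule.mem_top _) h₁ with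
      h₂ | ⟨l, hl, hlk, hf⟩
    · exact Or.inl h₂
    · exact Or.inr ⟨l, hl, hlk, fun h' => absurd hδ h', hf⟩
  · have hmem := h.split.mem_nilpotencySeries_succ.1
      (he.aeval_mem (Nat.lt_succ_self k) hk g) δ hδ u hu
    rcases h.eq_zero_or_exists he hk.le hmem h₁ with h₂ | ⟨l, hl, hlk, hf⟩
    · exact Or.inl h₂
    · exact Or.inr ⟨l, hl.trans hk, hlk, fun _ => hl, hf⟩

theorem linearMap_ext (h : IsShiftSystem U a y v m q s) (he : IsGeneratorSystem y v m q s e)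
    {A B : Module.End F U} (hAB : ∀ k < m, ∀ g : F[X],
      A (aeval (LieModule.toEnd F L U y) g (e k)) = B (aeval (LieModule.toEnd F L U y) g (e k))) :
    A = B := by
  ext w
  obtain ⟨g, rfl⟩ := he.exists_eq_sum le_rfl (h.top ▸ LieSubmodule.mem_top w)
  rw [map_sum, map_sum]
  exact Finset.sum_congr rfl fun k hk => hAB k (Finset.mem_range.1 hk) _

/-- By the Chinese remainder theorem, a shifted operator exists as a polynomial in `y`. -/
theorem exists_isShiftedOperator (h : IsShiftSystem U a y v m q s)
    (he : IsGeneratorSystem y v m q s e) : ∃ E : Module.End F U, IsShiftedOperator y m e E := by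
  obtain ⟨c, hc⟩ := Ideal.exists_forall_sub_mem_ideal
    (I := fun k : Fin m => Ideal.span {q.comp (X + C ((k : ℕ) : F)) ^ s k})
    (fun i j hij => (Ideal.isCoprime_span_singleton_iff _ _).2 (h.isCoprime (fun h' => hij
      (Fin.ext (h.cast_injective i i.2 j j.2 h'))) _ _))
    (fun k => C ((k : ℕ) : F))
  refine ⟨aeval (LieModule.toEnd F L U y) (X + c), ⟨fun k hk f g => ?_⟩⟩
  rw [← aeval_comp, ← aeval_mul_apply, ← sub_eq_zero, ← LinearMap.sub_apply, ← map_sub,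
    he.aeval_eq_zero_iff hk, ← sub_mul]
  refine Dvd.dvd.mul_right ?_ g
  have h₁ := sub_dvd_eval_sub (X + c) (X + C (k : F)) (f.map C)
  rw [eval_map, eval_map] at h₁
  have h₂ := Ideal.mem_span_singleton.1 (hc ⟨k, hk⟩)
  rw [add_sub_add_left_eq_sub] at h₁
  exact h₂.trans h₁

end IsShiftSystem

namespace IsShiftedOperator

variable {E : Module.End F U}

theorem aeval_generator (hE : IsShiftedOperator y m e E) {k : ℕ} (hk : k < m) (f : F[X]) :
    aeval E f (e k) = aeval (LieModule.toEnd F L U y) (f.comp (X + C (k : F))) (e k) := by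
  have := hE.aeval_apply k hk f 1
  rwa [mul_one, map_one, Module.End.one_apply] at this

theorem aeval_toEnd_generator (hE : IsShiftedOperator y m e E) {k : ℕ} (hk : k < m) (f : F[X]) :
    aeval (LieModule.toEnd F L U y) f (e k) = aeval E (f.comp (X + C (-(k : F)))) (e k) := by
  rw [hE.aeval_generator hk, comp_X_add_C_comp, neg_add_cancel, C_0, add_zero, comp_X]

theorem apply (hE : IsShiftedOperator y m e E) {k : ℕ} (hk : k < m) (g : F[X]) :
    E (aeval (LieModule.toEnd F L U y) g (e k)) =
      ⁅y, aeval (LieModule.toEnd F L U y) g (e k)⁆ +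
        (k : F) • aeval (LieModule.toEnd F L U y) g (e k) := by
  have := hE.aeval_apply k hk X g
  rw [aeval_X, X_comp, aeval_mul_apply] at this
  rw [this, map_add, aeval_X, aeval_C, LinearMap.add_apply, Module.algebraMap_end_apply,
    LieModule.toEnd_apply_apply]

theorem aeval_eq_zero_iff (hE : IsShiftedOperator y m e E) (he : IsGeneratorSystem y v m q s e)
    {k : ℕ} (hk : k < m) (f : F[X]) : aeval E f (e k) = 0 ↔ q ^ s k ∣ f := by
  rw [hE.aeval_generator hk, he.aeval_eq_zero_iff hk, ← pow_comp, comp_X_add_C_dvd_iff]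

theorem lie_succ (hE : IsShiftedOperator y m e E) (he : IsGeneratorSystem y v m q s e)
    {k : ℕ} (hk : k + 1 < m) : ⁅v, e (k + 1)⁆ = aeval E (q ^ (s k - s (k + 1))) (e k) := by
  rw [he.lie_succ k hk, hE.aeval_generator (by omega), pow_comp]

/-- `E` is an endomorphism of the module: an eigenvector of `ad y` with eigenvalue `δ` maps the
component on which `E - y` is `k` to the one on which it is `k - δ`. -/
theorem apply_lie (hE : IsShiftedOperator y m e E) (h : IsShiftSystem U a y v m q s)
    (he : IsGeneratorSystem y v m q s e) (z : L) (w : U) : E ⁅z, w⁆ = ⁅z, E w⁆ := by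
  have key : ∀ δ : F, ∀ u ∈ adEigenspace a y δ, ∀ w : U, E ⁅u, w⁆ = ⁅u, E w⁆ := by
    intro δ u hu w
    have : E ∘ₗ LieModule.toEnd F L U u = LieModule.toEnd F L U u ∘ₗ E := by
      refine h.linearMap_ext he fun k hk g => ?_
      simp only [LinearMap.comp_apply, LieModule.toEnd_apply_apply]
      have h₀ : ⁅u, ⁅y, aeval (LieModule.toEnd F L U y) g (e k)⁆⁆ =
          ⁅y, ⁅u, aeval (LieModule.toEnd F L U y) g (e k)⁆⁆ -
            δ • ⁅u, aeval (LieModule.toEnd F L U y) g (e k)⁆ := by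
        rw [leibniz_lie y u, hu.2, smul_lie, add_sub_cancel_left]
      rw [hE.apply hk, lie_add, lie_smul, h₀]
      rcases h.lie_eq_zero_or_exists he hk hu g with h₁ | ⟨l, hl, hlk, -, f, hf⟩
      · rw [h₁]; simp
      · rw [hf, hE.apply hl, ← hlk, sub_smul]
        abel
    exact LinearMap.congr_fun this w
  have hy : ∀ w : U, E ⁅y, w⁆ = ⁅y, E w⁆ := by
    intro w
    have : E ∘ₗ LieModule.toEnd F L U y = LieModule.toEnd F L U y ∘ₗ E := by
      refine h.linearMap_ext he fun k hk g => ?_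
      have h₁ := hE.apply hk (X * g)
      rw [aeval_mul_apply, aeval_X] at h₁
      rw [LinearMap.comp_apply, LinearMap.comp_apply, h₁, hE.apply hk, map_add, map_smul]
      rfl
    exact LinearMap.congr_fun this w
  obtain ⟨c, u, hu, rfl⟩ := h.split.exists_eq_smul_add z
  rw [add_lie, add_lie, smul_lie, smul_lie, map_add, map_smul, hy]
  congr 1
  have hu' : u ∈ ⨆ δ : F, adEigenspace a y δ := h.split.diagonal ▸ hu
  clear hu
  induction hu' using Submodule.iSup_induction' with
  | mem δ u hu => exact key δ u hu w
  | zero => simp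
  | add u u' hu hu' ih ih' => rw [add_lie, add_lie, map_add, ih, ih']

theorem aeval_lie (hE : IsShiftedOperator y m e E) (h : IsShiftSystem U a y v m q s)
    (he : IsGeneratorSystem y v m q s e) (f : F[X]) (z : L) (w : U) :
    aeval E f ⁅z, w⁆ = ⁅z, aeval E f w⁆ := by
  induction f using Polynomial.induction_on' generalizing w with
  | add f g hf hg => simp only [map_add, LinearMap.add_apply, hf, hg, lie_add]
  | monomial n c =>
    simp only [aeval_monomial, Module.End.mul_apply, Module.algebraMap_end_apply, lie_smul]
    congr 1
    induction n generalizing w with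
    | zero => simp
    | succ n ih =>
      rw [pow_succ, Module.End.mul_apply, Module.End.mul_apply, hE.apply_lie h he, ih]

end IsShiftedOperator
end Decomposition

/-! ### The basis and the matrices `A`, `E` and `T` -/

section Basis

variable {F : Type*} [Field F] {L : Type*} [LieRing L] [LieAlgebra F L]
variable {U : Type*} [AddCommGroup U] [Module F U] [LieRingModule L U] [LieModule F L U]
variable {a : LieIdeal F L} {y v : L} {m : ℕ} {q : F[X]} {s : ℕ → ℕ} {e : ℕ → U}

theorem aeval_apply_eq_sum {Y : Module.End F U} {f : F[X]} {n : ℕ} (hf : f.natDegree < n) (w : U) :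
    aeval Y f w = ∑ l : Fin n, f.coeff l • aeval Y ((X : F[X]) ^ (l : ℕ)) w := by
  rw [aeval_eq_sum_range' hf, LinearMap.sum_apply, Finset.sum_range]
  simp

theorem natDegree_comp_pow (q : F[X]) (γ : F) (t : ℕ) :
    (q.comp (X + C γ) ^ t).natDegree = q.natDegree * t := by
  rw [natDegree_pow, natDegree_comp, natDegree_X_add_C, mul_one, mul_comm]

namespace IsShiftSystem

theorem natDegree_pos (h : IsShiftSystem U a y v m q s) : 0 < q.natDegree :=
  h.irreducible.natDegree_pos

theorem mul_pos (h : IsShiftSystem U a y v m q s) {i : ℕ} (hi : i < m) : 0 < q.natDegree * s i :=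
  Nat.mul_pos h.natDegree_pos (h.pos i hi)

/-- Reduction modulo the annihilator of a generator. -/
theorem exists_natDegree_lt (h : IsShiftSystem U a y v m q s) (he : IsGeneratorSystem y v m q s e)
    {i : ℕ} (hi : i < m) (g : F[X]) : ∃ f : F[X], f.natDegree < q.natDegree * s i ∧
      aeval (LieModule.toEnd F L U y) g (e i) = aeval (LieModule.toEnd F L U y) f (e i) := by
  have hm : (q.comp (X + C (i : F)) ^ s i).Monic := (h.monic.comp_X_add_C _).pow _
  have hd := natDegree_comp_pow q (i : F) (s i)
  refine ⟨g %ₘ (q.comp (X + C (i : F)) ^ s i), ?_, ?_⟩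
  · rw [← hd]
    refine natDegree_modByMonic_lt g hm fun h1 => ?_
    rw [h1, natDegree_one] at hd
    exact (h.mul_pos hi).ne hd
  · conv_lhs => rw [← modByMonic_add_div g (q.comp (X + C (i : F)) ^ s i)]
    rw [map_add, LinearMap.add_apply, (he.aeval_eq_zero_iff hi _).2 (dvd_mul_right _ _), add_zero]

/-- The vectors `y ^ l e_i` with `l < d s_i` form a basis of `U`. -/
theorem exists_basis (h : IsShiftSystem U a y v m q s) (he : IsGeneratorSystem y v m q s e) :
    ∃ b : Module.Basis (BlockIndex q.natDegree fun i : Fin m => s i) F U, ∀ i l,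
      b ⟨i, l⟩ = aeval (LieModule.toEnd F L U y) ((X : F[X]) ^ (l : ℕ)) (e i) := by
  classical
  let w : (BlockIndex q.natDegree fun i : Fin m => s i) → U := fun x =>
    aeval (LieModule.toEnd F L U y) ((X : F[X]) ^ (x.2 : ℕ)) (e x.1)
  have hli : LinearIndependent F w := by
    rw [Fintype.linearIndependent_iff]
    rintro c hc ⟨i, l⟩
    let g : Fin m → F[X] := fun i => ∑ l : Fin (q.natDegree * s i), C (c ⟨i, l⟩) * X ^ (l : ℕ)
    have hg : ∀ i, aeval (LieModule.toEnd F L U y) (g i) (e i) =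
        ∑ l : Fin (q.natDegree * s i), c ⟨i, l⟩ • w ⟨i, l⟩ := by
      intro i
      simp only [g, map_sum, LinearMap.sum_apply]
      refine Finset.sum_congr rfl fun l _ => ?_
      rw [map_mul, aeval_C, Module.End.mul_apply, Module.algebraMap_end_apply]
    let g' : ℕ → F[X] := fun k => if hk : k < m then g ⟨k, hk⟩ else 0
    have hg' : ∀ i : Fin m, g' i = g i := fun i => dif_pos i.2
    have hsum : ∑ k ∈ Finset.range m, aeval (LieModule.toEnd F L U y) (g' k) (e k) = 0 := by
      rw [Finset.sum_range, ← hc, Fintype.sum_sigma]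
      exact Finset.sum_congr rfl fun i _ => by rw [hg', hg]
    have h₁ := he.aeval_eq_zero_of_sum le_rfl hsum i.2
    rw [hg', he.aeval_eq_zero_iff i.2] at h₁
    have hdeg : (g i).degree < (q.comp (X + C ((i : ℕ) : F)) ^ s i).degree := by
      rw [degree_eq_natDegree (((h.monic.comp_X_add_C _).pow _).ne_zero), natDegree_comp_pow]
      exact degree_sum_fin_lt _
    have h₂ : g i = 0 := eq_zero_of_dvd_of_degree_lt h₁ hdeg
    have h₃ : (g i).coeff l = c ⟨i, l⟩ := by
      simp only [g, finsetSum_coeff, coeff_C_mul, coeff_X_pow]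
      rw [Finset.sum_eq_single l]
      · simp
      · intro l' _ hl'
        rw [if_neg fun h' => hl' (Fin.ext h'.symm), mul_zero]
      · exact fun h' => absurd (Finset.mem_univ l) h'
    rw [← h₃, h₂, coeff_zero]
  have hsp : ⊤ ≤ Submodule.span F (Set.range w) := by
    intro z _
    obtain ⟨g, rfl⟩ := he.exists_eq_sum le_rfl (h.top ▸ LieSubmodule.mem_top z)
    refine Submodule.sum_mem _ fun k hk => ?_
    have hk := Finset.mem_range.1 hk
    obtain ⟨f, hf, hfg⟩ := h.exists_natDegree_lt he hk (g k)
    rw [hfg, aeval_apply_eq_sum hf]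
    exact Submodule.sum_mem _ fun l _ => Submodule.smul_mem _ _
      (Submodule.subset_span ⟨⟨⟨k, hk⟩, l⟩, rfl⟩)
  exact ⟨Module.Basis.mk hli hsp, fun i l => by rw [Module.Basis.mk_apply]⟩

end IsShiftSystem

section Matrices

variable {b : Module.Basis (BlockIndex q.natDegree fun i : Fin m => s i) F U}

theorem repr_aeval_apply
    (hb : ∀ i l, b ⟨i, l⟩ = aeval (LieModule.toEnd F L U y) ((X : F[X]) ^ (l : ℕ)) (e i))
    (i : Fin m)
    {f : F[X]} (hf : f.natDegree < q.natDegree * s i)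
    (r : BlockIndex q.natDegree fun i : Fin m => s i) :
    b.repr (aeval (LieModule.toEnd F L U y) f (e i)) r =
      if r.1 = i then f.coeff r.2 else 0 := by
  classical
  rw [aeval_apply_eq_sum hf]
  simp only [← hb, map_sum, map_smul, Module.Basis.repr_self, Finsupp.coe_finsetSum,
    Finset.sum_apply, Finsupp.smul_apply, Finsupp.single_apply, smul_eq_mul, mul_ite, mul_one,
    mul_zero]
  obtain ⟨k, l⟩ := r
  split_ifs with hki
  · subst hki
    rw [Finset.sum_eq_single l]
    · rw [if_pos rfl]
    · intro l' _ hl'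
      rw [if_neg]
      intro h'
      exact hl' (by simpa using h')
    · exact fun h' => absurd (Finset.mem_univ l) h'
  · refine Finset.sum_eq_zero fun l' _ => if_neg fun h' => hki ?_
    exact (congrArg Sigma.fst h').symm

theorem IsShiftSystem.toMatrix_toEnd (h : IsShiftSystem U a y v m q s)
    (he : IsGeneratorSystem y v m q s e)
    (hb : ∀ i l, b ⟨i, l⟩ = aeval (LieModule.toEnd F L U y) ((X : F[X]) ^ (l : ℕ)) (e i)) :
    LinearMap.toMatrix b b (LieModule.toEnd F L U y) =
      matA q.natDegree (fun i : Fin m => q.comp (X + C ((i : ℕ) : F))) fun i : Fin m => s i := by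
  ext r ⟨i, l⟩
  have hpos := h.mul_pos i.2
  have hX : LieModule.toEnd F L U y (b ⟨i, l⟩) =
      aeval (LieModule.toEnd F L U y) ((X : F[X]) ^ ((l : ℕ) + 1)) (e i) := by
    rw [hb, pow_succ', aeval_mul_apply, aeval_X]
  rw [LinearMap.toMatrix_apply, hX, matA]
  by_cases hl : (l : ℕ) + 1 = q.natDegree * s i
  · set f := q.comp (X + C ((i : ℕ) : F)) ^ s i with hf
    have hfd : f.natDegree = q.natDegree * s i := natDegree_comp_pow _ _ _
    have hfm : f.Monic := (h.monic.comp_X_add_C _).pow _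
    have hred : aeval (LieModule.toEnd F L U y) ((X : F[X]) ^ ((l : ℕ) + 1)) (e i) =
        aeval (LieModule.toEnd F L U y) ((X : F[X]) ^ ((l : ℕ) + 1) - f) (e i) := by
      rw [map_sub, LinearMap.sub_apply, he.aeval_eq_zero i i.2, sub_zero]
    have hdeg : (X ^ ((l : ℕ) + 1) - f).natDegree < q.natDegree * s i := by
      refine lt_of_lt_of_eq ?_ hl
      exact (isMonicOfDegree_X_pow F _).natDegree_sub_lt (Nat.succ_ne_zero _)
        ⟨hfd.trans hl.symm, hfm⟩
    rw [hred, repr_aeval_apply hb i hdeg]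
    obtain ⟨k, r⟩ := r
    split_ifs with hki
    · subst hki
      rw [Matrix.blockDiagonal'_apply_eq, companion, if_pos hl, coeff_sub, coeff_X_pow,
        if_neg, zero_sub]
      have h₁ : (r : ℕ) < q.natDegree * s k := r.2
      exact fun h₂ : (r : ℕ) = (l : ℕ) + 1 => (h₁.trans_eq hl.symm).ne h₂
    · rw [Matrix.blockDiagonal'_apply_ne _ _ _ hki]
  · have hlt : (l : ℕ) + 1 < q.natDegree * s i := lt_of_le_of_ne l.2 hl
    rw [repr_aeval_apply hb i (by rwa [natDegree_X_pow])]
    obtain ⟨k, r⟩ := r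
    split_ifs with hki
    · subst hki
      rw [Matrix.blockDiagonal'_apply_eq, companion, if_neg hl, coeff_X_pow]
    · rw [Matrix.blockDiagonal'_apply_ne _ _ _ hki]

theorem matE_eq_matA_add (d : ℕ) (p : Fin m → F[X]) (σ : Fin m → ℕ) :
    matE d p σ = matA d p σ +
      Matrix.diagonal fun r : BlockIndex d σ => ((r.1 : ℕ) : F) := by
  ext ⟨k, r⟩ ⟨i, l⟩
  rw [matE, matA, Matrix.add_apply]
  by_cases hki : k = i
  · subst hki
    rw [Matrix.blockDiagonal'_apply_eq, Matrix.blockDiagonal'_apply_eq, Matrix.add_apply,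
      Matrix.smul_apply, Matrix.one_apply, Matrix.diagonal_apply]
    simp
  · rw [Matrix.blockDiagonal'_apply_ne _ _ _ hki, Matrix.blockDiagonal'_apply_ne _ _ _ hki,
      Matrix.diagonal_apply_ne _ (fun h' => hki (congrArg Sigma.fst h')), add_zero]

theorem IsShiftedOperator.toMatrix {E : Module.End F U} (hE : IsShiftedOperator y m e E)
    (h : IsShiftSystem U a y v m q s) (he : IsGeneratorSystem y v m q s e)
    (hb : ∀ i l, b ⟨i, l⟩ = aeval (LieModule.toEnd F L U y) ((X : F[X]) ^ (l : ℕ)) (e i)) :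
    LinearMap.toMatrix b b E =
      matE q.natDegree (fun i : Fin m => q.comp (X + C ((i : ℕ) : F))) fun i : Fin m => s i := by
  rw [matE_eq_matA_add, ← h.toMatrix_toEnd he hb]
  ext r ⟨i, l⟩
  rw [Matrix.add_apply, LinearMap.toMatrix_apply, LinearMap.toMatrix_apply]
  have h₁ := hE.apply i.2 (X ^ (l : ℕ))
  rw [← hb] at h₁
  rw [h₁, map_add, map_smul, Finsupp.add_apply, Finsupp.smul_apply, Module.Basis.repr_self,
    Matrix.diagonal_apply, Finsupp.single_apply, LieModule.toEnd_apply_apply]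
  congr 1
  by_cases hr : r = ⟨i, l⟩
  · subst hr; simp
  · rw [if_neg (Ne.symm hr), if_neg hr, smul_zero]

/-- The matrix of `v` is `T`, since `v y ^ l = (y - 1) ^ l v` and the generators are adapted
to `v`. -/
theorem IsShiftSystem.toMatrix_shift (h : IsShiftSystem U a y v m q s)
    (he : IsGeneratorSystem y v m q s e)
    (hb : ∀ i l, b ⟨i, l⟩ = aeval (LieModule.toEnd F L U y) ((X : F[X]) ^ (l : ℕ)) (e i)) :
    LinearMap.toMatrix b b (LieModule.toEnd F L U v) =
      matT q.natDegree (fun i : Fin m => q.comp (X + C ((i : ℕ) : F))) fun i : Fin m => s i := by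
  ext r ⟨⟨i, hi⟩, l⟩
  have hv : ⁅y, v⁆ = (1 : F) • v := h.mem.2
  have hT : ⁅v, b ⟨⟨i, hi⟩, l⟩⁆ =
      aeval (LieModule.toEnd F L U y) ((X - 1 : F[X]) ^ (l : ℕ)) ⁅v, e i⁆ := by
    rw [hb, aeval_apply_of_lie_eq_smul hv]
    congr 2
    simp
  rw [LinearMap.toMatrix_apply, matT, LieModule.toEnd_apply_apply, hT]
  rcases i with _ | i
  · have h₀ : ⁅v, e 0⁆ = 0 := h.lie_mem (n := 0) (he.generator 0 hi).mem
    rw [h₀, map_zero, map_zero, Finsupp.zero_apply, if_neg (by simp)]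
  · have hle := h.le i hi
    have hd := h.natDegree_pos
    have hdeg : ((X - 1 : F[X]) ^ (l : ℕ) * q.comp (X + C (i : F)) ^ (s i - s (i + 1))).natDegree <
        q.natDegree * s i := by
      refine lt_of_le_of_lt natDegree_mul_le ?_
      rw [natDegree_comp_pow, natDegree_pow]
      have h₁ : (X - 1 : F[X]).natDegree = 1 := by
        rw [← C_1]; exact natDegree_X_sub_C 1
      have h₂ : (l : ℕ) < q.natDegree * s (i + 1) := l.2
      have h₃ : q.natDegree * s i = q.natDegree * (s i - s (i + 1)) + q.natDegree * s (i + 1) := by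
        rw [← mul_add, Nat.sub_add_cancel hle]
      rw [h₁]
      omega
    rw [he.lie_succ i hi, ← aeval_mul_apply,
      repr_aeval_apply hb ⟨i, by omega⟩ (f := _) hdeg]
    obtain ⟨⟨k, hk⟩, r⟩ := r
    by_cases hki : k = i
    · subst hki
      rw [if_pos rfl, if_pos rfl]
    · rw [if_neg (fun h' => hki (congrArg Fin.val h')), if_neg]
      simpa using hki

end Matrices
end Basis

/-! ### The action of `a(j)` -/

section Action

variable {F : Type*} [Field F] {L : Type*} [LieRing L] [LieAlgebra F L]
variable {U : Type*} [AddCommGroup U] [Module F U] [LieRingModule L U] [LieModule F L U]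
variable {a : LieIdeal F L} {y v : L} {m : ℕ} {q : F[X]} {s : ℕ → ℕ} {e : ℕ → U}
variable {E : Module.End F U}

namespace IsShiftSystem

theorem antitone (h : IsShiftSystem U a y v m q s) {i j : ℕ} (hij : i + j < m) :
    s (i + j) ≤ s i := by
  induction j with
  | zero => exact le_rfl
  | succ j ih => exact (h.le (i + j) hij).trans (ih (by omega))

theorem pow_apply_eq_zero (h : IsShiftSystem U a y v m q s) {j n : ℕ} (hn : n ≤ j) {w : U}
    (hw : w ∈ nilpotencySeries F L U n) : (LieModule.toEnd F L U v ^ j) w = 0 := by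
  induction j generalizing n w with
  | zero =>
    obtain rfl : n = 0 := by omega
    rw [show w = 0 from hw, map_zero]
  | succ j ih =>
    rw [pow_succ, Module.End.mul_apply, LieModule.toEnd_apply_apply]
    rcases n with _ | n
    · rw [show w = 0 from hw, lie_zero, map_zero]
    · exact ih (by omega) (h.lie_mem hw)

/-- `v` acts non-trivially. -/
theorem lie_generator_ne_zero (h : IsShiftSystem U a y v m q s)
    (he : IsGeneratorSystem y v m q s e) (hm : 1 < m) : ⁅v, e 1⁆ ≠ 0 := by
  intro h₀
  rw [he.lie_succ 0 hm, he.aeval_eq_zero_iff (by omega)] at h₀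
  have hirr := irreducible_comp_X_add_C h.irreducible ((0 : ℕ) : F)
  have h₁ := (pow_dvd_pow_iff hirr.ne_zero hirr.not_isUnit).1 h₀
  have h₂ := h.pos 1 hm
  have h₃ := h.le 0 hm
  simp only [zero_add] at h₁ h₃
  omega

/-- Only the spaces `a(j)` with `0 ≤ j < m` act non-trivially. -/
theorem exists_eq_natCast (h : IsShiftSystem U a y v m q s) (he : IsGeneratorSystem y v m q s e)
    {δ : F} {u : L} (hu : u ∈ adEigenspace a y δ) {w : U} (hw : ⁅u, w⁆ ≠ 0) :
    ∃ j < m, δ = (j : F) := by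
  by_contra! hcon
  apply hw
  have : LieModule.toEnd F L U u = 0 := by
    refine h.linearMap_ext he fun k hk g => ?_
    rw [LieModule.toEnd_apply_apply, LinearMap.zero_apply]
    rcases h.lie_eq_zero_or_exists he hk hu g with h₁ | ⟨l, hl, hkl, hlt, -⟩
    · exact h₁
    · exfalso
      by_cases hδ : δ = 0
      · exact hcon 0 (by omega) (by rw [hδ, Nat.cast_zero])
      · have := hlt hδ
        refine hcon (k - l) (by omega) ?_
        rw [Nat.cast_sub this.le, ← hkl, sub_sub_cancel]
  rw [← LieModule.toEnd_apply_apply F L U, this, LinearMap.zero_apply]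

end IsShiftSystem

namespace IsShiftedOperator

theorem aeval_pow_apply (hE : IsShiftedOperator y m e E) (h : IsShiftSystem U a y v m q s)
    (he : IsGeneratorSystem y v m q s e) (f : F[X]) (j : ℕ) (w : U) :
    aeval E f ((LieModule.toEnd F L U v ^ j) w) =
      (LieModule.toEnd F L U v ^ j) (aeval E f w) := by
  induction j generalizing w with
  | zero => rfl
  | succ j ih =>
    rw [pow_succ, Module.End.mul_apply, Module.End.mul_apply, ih, LieModule.toEnd_apply_apply,
      LieModule.toEnd_apply_apply, hE.aeval_lie h he]

theorem pow_apply_generator (hE : IsShiftedOperator y m e E) (h : IsShiftSystem U a y v m q s)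
    (he : IsGeneratorSystem y v m q s e) {r j : ℕ} (hr : r + j < m) :
    (LieModule.toEnd F L U v ^ j) (e (r + j)) = aeval E (q ^ (s r - s (r + j))) (e r) := by
  induction j with
  | zero => simp
  | succ j ih =>
    have h₁ := h.antitone (i := r) (j := j) (by omega)
    have h₂ := h.le (r + j) hr
    rw [pow_succ, Module.End.mul_apply, LieModule.toEnd_apply_apply, ← add_assoc,
      hE.lie_succ he (k := r + j) hr, ← hE.aeval_pow_apply h he, ih (by omega),
      ← aeval_mul_apply, ← pow_add]
    congr 3
    omega

/-- `v ^ j f(E)` vanishes on `e_j` only if `f` is divisible by `q ^ s_j`. -/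
theorem pow_apply_aeval_eq_zero (hE : IsShiftedOperator y m e E) (h : IsShiftSystem U a y v m q s)
    (he : IsGeneratorSystem y v m q s e) {j : ℕ} (hj : j < m) {f : F[X]}
    (hf : (LieModule.toEnd F L U v ^ j) (aeval E f (e j)) = 0) : q ^ s j ∣ f := by
  have h₁ := hE.pow_apply_generator h he (r := 0) (j := j) (by omega)
  have h₂ := h.antitone (i := 0) (j := j) (by omega)
  rw [zero_add] at h₁ h₂
  rw [← hE.aeval_pow_apply h he, h₁, ← aeval_mul_apply, hE.aeval_eq_zero_iff he (by omega)] at hf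
  rw [← Nat.sub_add_cancel h₂, pow_add, mul_comm f] at hf
  rw [Nat.add_sub_cancel] at hf
  exact (mul_dvd_mul_iff_left (pow_ne_zero _ h.irreducible.ne_zero)).1 hf

/-- An element of `a(j)` acts on `U` as `v ^ j g(E)`: this holds on `e_j` by uniseriality of the
first factor, and extends to the other generators since everything commutes with `v` and `E`. -/
theorem exists_lie_eq (hE : IsShiftedOperator y m e E) (h : IsShiftSystem U a y v m q s)
    (he : IsGeneratorSystem y v m q s e) {j : ℕ} (hj : j < m) {u : L}
    (hu : u ∈ adEigenspace a y (j : F)) :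
    ∃ g ∈ degreeLT F (q.natDegree * s j), ∀ w : U,
      ⁅u, w⁆ = (LieModule.toEnd F L U v ^ j) (aeval E g w) := by
  -- `u` maps the `k`-th component to the `(k - j)`-th one
  have hcomp : ∀ k < m, ⁅u, e k⁆ = 0 ∨ ∃ r, r + j = k ∧ ∃ f : F[X], ⁅u, e k⁆ = aeval E f (e r) := by
    intro k hk
    have h₁ := h.lie_eq_zero_or_exists he hk hu 1
    rw [map_one, Module.End.one_apply] at h₁
    refine h₁.imp id ?_
    rintro ⟨l, hl, hkl, hlt, f, hf⟩
    refine ⟨l, ?_, f.comp (X + C (-(l : F))), by rw [hf, hE.aeval_toEnd_generator hl]⟩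
    by_cases hj0 : (j : F) = 0
    · have : j = 0 := h.cast_injective j hj 0 (by omega) (by rw [hj0, Nat.cast_zero])
      rw [hj0, sub_zero] at hkl
      rw [this, add_zero, h.cast_injective k hk l hl hkl]
    · have hlk := hlt hj0
      have : (j : F) = ((k - l : ℕ) : F) := by
        rw [Nat.cast_sub hlk.le, ← hkl, sub_sub_cancel]
      have := h.cast_injective j hj (k - l) (by omega) this
      omega
  have hle : ∀ r, r + j < m → s (r + j) ≤ s r := fun r hr => h.antitone hr
  -- the polynomial `g`
  obtain ⟨f₀, hf₀⟩ : ∃ f : F[X], ⁅u, e j⁆ = aeval E f (e 0) := by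
    rcases hcomp j hj with h₁ | ⟨r, hr, f, hf⟩
    · exact ⟨0, by rw [h₁, map_zero, LinearMap.zero_apply]⟩
    · obtain rfl : r = 0 := by omega
      exact ⟨f, hf⟩
  have hle0 : s j ≤ s 0 := by simpa using hle 0 (by omega)
  have hdvd : q ^ (s 0 - s j) ∣ f₀ := by
    have h₁ : aeval E (q ^ s j * f₀) (e 0) = 0 := by
      rw [aeval_mul_apply, ← hf₀, hE.aeval_lie h he, (hE.aeval_eq_zero_iff he hj _).2 dvd_rfl,
        lie_zero]
    rw [hE.aeval_eq_zero_iff he (by omega), ← Nat.add_sub_cancel' hle0, pow_add] at h₁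
    exact (mul_dvd_mul_iff_left (pow_ne_zero _ h.irreducible.ne_zero)).1 h₁
  obtain ⟨g₀, rfl⟩ := hdvd
  have hmonic : (q ^ s j).Monic := h.monic.pow _
  have hg : ⁅u, e j⁆ = (LieModule.toEnd F L U v ^ j) (aeval E (g₀ %ₘ q ^ s j) (e j)) := by
    have h₁ : aeval E (g₀ %ₘ q ^ s j) (e j) = aeval E g₀ (e j) := by
      conv_rhs => rw [← modByMonic_add_div g₀ (q ^ s j)]
      rw [map_add, LinearMap.add_apply, (hE.aeval_eq_zero_iff he hj _).2 (dvd_mul_right _ _),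
        add_zero]
    have h₂ := hE.pow_apply_generator h he (r := 0) (j := j) (by omega)
    rw [zero_add] at h₂
    rw [h₁, ← hE.aeval_pow_apply h he, h₂, hf₀, ← aeval_mul_apply, mul_comm]
  refine ⟨g₀ %ₘ q ^ s j, ?_, ?_⟩
  · rw [mem_degreeLT]
    refine (degree_modByMonic_lt g₀ hmonic).trans_eq ?_
    rw [degree_eq_natDegree hmonic.ne_zero, natDegree_pow, mul_comm]
  generalize g₀ %ₘ q ^ s j = g at hg
  have hgen : ∀ k < m, ⁅u, e k⁆ = (LieModule.toEnd F L U v ^ j) (aeval E g (e k)) := by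
    intro k hk
    by_cases hkj : k < j
    · rw [← hE.aeval_pow_apply h he, h.pow_apply_eq_zero hkj (he.generator k hk).mem, map_zero]
      exact (hcomp k hk).resolve_right fun ⟨r, hr, _⟩ => by omega
    obtain ⟨r, rfl⟩ : ∃ r, k = r + j := ⟨k - j, by omega⟩
    obtain ⟨f, hf⟩ : ∃ f : F[X], ⁅u, e (r + j)⁆ = aeval E f (e r) := by
      rcases hcomp _ hk with h₁ | ⟨r', hr, f, hf⟩
      · exact ⟨0, by rw [h₁, map_zero, LinearMap.zero_apply]⟩
      · obtain rfl : r' = r := by omega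
        exact ⟨f, hf⟩
    -- both sides are in the `r`-th component, on which `v ^ r` is injective
    have h₁ := hE.pow_apply_generator h he hk
    rw [hf, ← hE.aeval_pow_apply h he, h₁, ← aeval_mul_apply, ← sub_eq_zero,
      ← LinearMap.sub_apply, ← map_sub, hE.aeval_eq_zero_iff he (by omega)]
    refine hE.pow_apply_aeval_eq_zero h he (by omega) ?_
    have hcomm : ∀ (n : ℕ) (w : U), (LieModule.toEnd F L U v ^ n) ⁅u, w⁆ =
        ⁅u, (LieModule.toEnd F L U v ^ n) w⁆ := by
      intro n w
      induction n generalizing w with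
      | zero => rfl
      | succ n ih =>
        rw [pow_succ, Module.End.mul_apply, Module.End.mul_apply, LieModule.toEnd_apply_apply,
          LieModule.toEnd_apply_apply, h.split.lie_comm_of_mem h.mem.1 hu.1, ih]
    have h₂ := hE.pow_apply_generator h he (r := j) (j := r) (by omega)
    rw [add_comm j r] at h₂
    rw [map_sub, LinearMap.sub_apply, map_sub, aeval_mul_apply, ← h₁, sub_eq_zero]
    calc (LieModule.toEnd F L U v ^ r) (aeval E f (e r))
        = ⁅u, aeval E (q ^ (s j - s (r + j))) (e j)⁆ := by rw [← hf, hcomm, h₂]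
      _ = (LieModule.toEnd F L U v ^ j) (aeval E g (aeval E (q ^ (s j - s (r + j))) (e j))) := by
          rw [← hE.aeval_lie h he, hg, hE.aeval_pow_apply h he, aeval_apply_comm]
      _ = (LieModule.toEnd F L U v ^ (j + r)) (aeval E g (e (r + j))) := by
          rw [← h₂, hE.aeval_pow_apply h he, pow_add, Module.End.mul_apply]
      _ = (LieModule.toEnd F L U v ^ r)
            (aeval E g ((LieModule.toEnd F L U v ^ j) (e (r + j)))) := by
          rw [hE.aeval_pow_apply h he, add_comm j r, pow_add, Module.End.mul_apply]
  intro w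
  have : LieModule.toEnd F L U u = (LieModule.toEnd F L U v ^ j) ∘ₗ aeval E g := by
    refine h.linearMap_ext he fun k hk f => ?_
    rw [hE.aeval_toEnd_generator hk, LieModule.toEnd_apply_apply, ← hE.aeval_lie h he, hgen k hk,
      LinearMap.comp_apply, aeval_apply_comm, hE.aeval_pow_apply h he]
  exact LinearMap.congr_fun this w

/-- The linear maps `g^j : a(j) → F[X]_(d s_j)` with `u = v ^ j g^j_u(E)` on `U`. -/
theorem exists_linearMap (hE : IsShiftedOperator y m e E) (h : IsShiftSystem U a y v m q s)
    (he : IsGeneratorSystem y v m q s e) {j : ℕ} (hj : j < m) :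
    ∃ g : adEigenspace a y (j : F) →ₗ[F] degreeLT F (q.natDegree * s j),
      ∀ (u : adEigenspace a y (j : F)) (w : U), ⁅(u : L), w⁆ =
        (LieModule.toEnd F L U v ^ j) (aeval E (g u : F[X]) w) := by
  choose g hg hgu using fun u : adEigenspace a y (j : F) => hE.exists_lie_eq h he hj u.2
  have huniq : ∀ f ∈ degreeLT F (q.natDegree * s j), ∀ f' ∈ degreeLT F (q.natDegree * s j),
      (LieModule.toEnd F L U v ^ j) (aeval E f (e j)) =
        (LieModule.toEnd F L U v ^ j) (aeval E f' (e j)) → f = f' := by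
    intro f hf f' hf' heq
    rw [← sub_eq_zero, ← map_sub, ← LinearMap.sub_apply, ← map_sub] at heq
    have h₁ := hE.pow_apply_aeval_eq_zero h he hj heq
    refine sub_eq_zero.1 (eq_zero_of_dvd_of_degree_lt h₁ ?_)
    rw [degree_eq_natDegree (h.monic.pow _).ne_zero, natDegree_pow, mul_comm]
    exact mem_degreeLT.1 (sub_mem hf hf')
  refine ⟨{ toFun := fun u => ⟨g u, hg u⟩, map_add' := fun u u' => ?_, map_smul' := fun c u => ?_ },
    fun u w => hgu u w⟩
  · refine Subtype.ext (huniq _ (hg _) (g u + g u') (add_mem (hg _) (hg _)) ?_)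
    rw [← hgu, map_add, LinearMap.add_apply, map_add, ← hgu, ← hgu, ← add_lie]
    rfl
  · refine Subtype.ext (huniq _ (hg _) (c • g u) (Submodule.smul_mem _ c (hg _)) ?_)
    rw [← hgu, map_smul, LinearMap.smul_apply, map_smul, ← hgu, ← smul_lie]
    rfl

theorem eq_one_of_lie_eq (hE : IsShiftedOperator y m e E) (h : IsShiftSystem U a y v m q s)
    (he : IsGeneratorSystem y v m q s e) (hm : 1 < m) {g : F[X]}
    (hg : g ∈ degreeLT F (q.natDegree * s 1))
    (hgv : ∀ w : U, ⁅v, w⁆ = (LieModule.toEnd F L U v ^ 1) (aeval E g w)) : g = 1 := by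
  have h₁ : q ^ s 1 ∣ g - 1 := by
    refine hE.pow_apply_aeval_eq_zero h he hm ?_
    rw [map_sub, LinearMap.sub_apply, map_sub, ← hgv, map_one, Module.End.one_apply, pow_one,
      LieModule.toEnd_apply_apply, sub_self]
  refine sub_eq_zero.1 (eq_zero_of_dvd_of_degree_lt h₁ ?_)
  rw [degree_eq_natDegree (h.monic.pow _).ne_zero, natDegree_pow, mul_comm]
  refine mem_degreeLT.1 (sub_mem hg (mem_degreeLT.2 ?_))
  rw [degree_one]
  exact_mod_cast h.mul_pos hm

end IsShiftedOperator
end Action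

/-! ### Uniseriality and semisimplicity -/

section Uniserial

variable {F : Type*} [Field F] {L : Type*} [LieRing L] [LieAlgebra F L]
variable {U : Type*} [AddCommGroup U] [Module F U] [LieRingModule L U] [LieModule F L U]
variable {a : LieIdeal F L} {y v : L} {m : ℕ} {q : F[X]} {s : ℕ → ℕ} {e : ℕ → U}
variable {E : Module.End F U}

namespace IsShiftSystem

/-- If the factors are irreducible, then a submodule that contains `U^(n)` and meets `U^(n+1)`
outside `U^(n)` contains `U^(n+1)`. -/
theorem nilpotencySeries_succ_le (h : IsShiftSystem U a y v m q s) (hs : ∀ i < m, s i = 1)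
    (P : LieSubmodule F L U) {n : ℕ} (hn : n < m) (hP : nilpotencySeries F L U n ≤ P) {w : U}
    (hwP : w ∈ P) (hw : w ∈ nilpotencySeries F L U (n + 1))
    (hw' : w ∉ nilpotencySeries F L U n) : nilpotencySeries F L U (n + 1) ≤ P := by
  obtain ⟨e, he⟩ := h.exists_generator n hn
  have hirr := irreducible_comp_X_add_C h.irreducible (n : F)
  have hdvd := he.aeval_mem_iff
  rw [hs n hn, pow_one] at hdvd
  obtain ⟨f, hf⟩ := he.exists_sub_mem w hw
  have hnd : ¬ q.comp (X + C (n : F)) ∣ f := by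
    rw [← hdvd]
    intro h₁
    have := add_mem hf h₁
    rw [sub_add_cancel] at this
    exact hw' this
  obtain ⟨r, t, hrt⟩ := (hirr.coprime_iff_not_dvd).2 hnd
  have heP : e ∈ P := by
    have h₁ := (hdvd (r * q.comp (X + C (n : F)))).2 (dvd_mul_left _ _)
    have h₂ := aeval_toEnd_mem_lieSubmodule _ y t hf
    have h₃ : e = aeval (LieModule.toEnd F L U y) (r * q.comp (X + C (n : F))) e +
        aeval (LieModule.toEnd F L U y) (t * f) e := by
      rw [← LinearMap.add_apply, ← map_add, hrt, map_one, Module.End.one_apply]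
    rw [h₃, aeval_mul_apply _ t f]
    have h₄ := sub_mem (aeval_toEnd_mem_lieSubmodule P y t hwP) (hP h₂)
    rw [map_sub, sub_sub_cancel] at h₄
    exact add_mem (hP h₁) h₄
  intro w' hw'
  obtain ⟨g, hg⟩ := he.exists_sub_mem w' hw'
  have := add_mem (hP hg) (aeval_toEnd_mem_lieSubmodule P y g heP)
  rwa [sub_add_cancel] at this

/-- As `nilpotencySeries_succ_le`, but without assuming that `P` contains `U^(n)`: apply `v` and use
induction. -/
theorem nilpotencySeries_le (h : IsShiftSystem U a y v m q s) (hs : ∀ i < m, s i = 1)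
    (P : LieSubmodule F L U) {n : ℕ} (hn : n < m) {w : U} (hwP : w ∈ P)
    (hw : w ∈ nilpotencySeries F L U (n + 1)) (hw' : w ∉ nilpotencySeries F L U n) :
    nilpotencySeries F L U (n + 1) ≤ P := by
  induction n generalizing w with
  | zero => exact h.nilpotencySeries_succ_le hs P hn bot_le hwP hw hw'
  | succ n ih =>
    refine h.nilpotencySeries_succ_le hs P hn ?_ hwP hw hw'
    exact ih (by omega) (P.lie_mem (x := v) hwP) (h.lie_mem hw)
      fun hvw => hw' (h.injective n w hw hvw)

/-- If the factors are irreducible, then `U` is uniserial: its only submodules are the terms of the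
nilpotency series. -/
theorem isUniserialLie (h : IsShiftSystem U a y v m q s) (hs : ∀ i < m, s i = 1) :
    IsUniserialLie F L U := by
  classical
  have key : ∀ P : LieSubmodule F L U, ∃ n, P = nilpotencySeries F L U n := by
    intro P
    have hex : ∃ n, P ≤ nilpotencySeries F L U n := ⟨m, h.top ▸ le_top⟩
    refine ⟨Nat.find hex, le_antisymm (Nat.find_spec hex) ?_⟩
    have hle : Nat.find hex ≤ m := Nat.find_min' hex (h.top ▸ le_top)
    have hmin : ∀ k < Nat.find hex, ¬ P ≤ nilpotencySeries F L U k := fun k hk =>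
      Nat.find_min hex hk
    have hspec := Nat.find_spec hex
    generalize Nat.find hex = n at hle hmin hspec
    rcases n with _ | n
    · exact bot_le
    · obtain ⟨w, hwP, hw⟩ := SetLike.not_le_iff_exists.1 (hmin n (Nat.lt_succ_self n))
      exact h.nilpotencySeries_le hs P hle hwP (hspec hwP) hw
  intro P Q
  obtain ⟨n, rfl⟩ := key P
  obtain ⟨k, rfl⟩ := key Q
  exact (le_total n k).imp (fun h => nilpotencySeries_mono h) (fun h => nilpotencySeries_mono h)

/-- If all `s_i = 1`, then `y` is annihilated by the product of the pairwise coprime irreducible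
polynomials `q_i`. -/
theorem isSemisimple_toEnd (h : IsShiftSystem U a y v m q s) (hs : ∀ i < m, s i = 1) :
    (LieModule.toEnd F L U y).IsSemisimple := by
  have hsq : Squarefree (∏ k ∈ Finset.range m, q.comp (X + C (k : F)) ^ s k) := by
    refine Finset.squarefree_prod_of_pairwise_isCoprime (fun i hi j hj hij => ?_) fun i hi => ?_
    · refine (h.isCoprime (fun h' => hij ?_) _ _).isRelPrime
      exact h.cast_injective i (Finset.mem_range.1 hi) j (Finset.mem_range.1 hj) h'
    · rw [hs i (Finset.mem_range.1 hi), pow_one]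
      exact (irreducible_comp_X_add_C h.irreducible _).squarefree
  refine Module.End.isSemisimple_of_squarefree_aeval_eq_zero hsq (LinearMap.ext fun w => ?_)
  exact h.aeval_prod_eq_zero le_rfl (h.top ▸ LieSubmodule.mem_top w)

end IsShiftSystem

/-- If `U` is uniserial, comparing `U^(1)` with the submodule `ker q(E)` yields `s_0 = 1`. -/
theorem IsShiftedOperator.eq_one_of_isUniserialLie (hE : IsShiftedOperator y m e E)
    (h : IsShiftSystem U a y v m q s) (he : IsGeneratorSystem y v m q s e) (hm : 1 < m)
    (hU : IsUniserialLie F L U) {i : ℕ} (hi : i < m) : s i = 1 := by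
  let K : LieSubmodule F L U :=
    { LinearMap.ker (aeval E q) with
      lie_mem := fun {z w} (hw : aeval E q w = 0) => by
        change aeval E q ⁅z, w⁆ = 0
        rw [hE.aeval_lie h he, hw, lie_zero] }
  have hle0 : s 0 ≤ 1 := by
    rcases hU (nilpotencySeries F L U 1) K with h₁ | h₁
    · have h₂ : aeval E q (e 0) = 0 := h₁ (he.generator 0 (by omega)).mem
      rw [hE.aeval_eq_zero_iff he (by omega)] at h₂
      have h₃ : q ^ s 0 ∣ q ^ 1 := by rwa [pow_one]
      exact (pow_dvd_pow_iff h.irreducible.ne_zero h.irreducible.not_isUnit).1 h₃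
    · exfalso
      have hpos := h.pos 1 hm
      have h₂ : aeval E (q ^ (s 1 - 1)) (e 1) ∈ K := by
        change aeval E q _ = 0
        rw [← aeval_mul_apply, hE.aeval_eq_zero_iff he hm, ← pow_succ', Nat.sub_add_cancel hpos]
      have h₃ := h₁ h₂
      rw [hE.aeval_generator hm, (he.generator 1 hm).aeval_mem_iff, ← pow_comp,
        comp_X_add_C_dvd_iff,
        pow_dvd_pow_iff h.irreducible.ne_zero h.irreducible.not_isUnit] at h₃
      omega
  have h₁ := h.pos i hi
  have h₂ := h.antitone (i := 0) (j := i) (by omega)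
  rw [zero_add] at h₂
  omega

theorem isSemisimple_of_eq_smul_add {f g : Module.End F U} {α c : F}
    (hfg : f = α • g + c • LinearMap.id) (hα : α ≠ 0) (hf : f.IsSemisimple) : g.IsSemisimple := by
  have hinv : f.invtSubmodule = g.invtSubmodule := by
    refine SetLike.ext fun P => ?_
    simp only [Module.End.mem_invtSubmodule_iff_forall_mem_of_mem]
    refine forall₂_congr fun w hw => ?_
    rw [hfg]
    simp only [LinearMap.add_apply, LinearMap.smul_apply, LinearMap.id_apply]
    rw [P.add_mem_iff_left (P.smul_mem c hw), P.smul_mem_iff hα]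
  rw [Module.End.isSemisimple_iff] at hf ⊢
  simpa only [hinv] using hf

end Uniserial

/-! ### The image of `L` in matrices -/

section Image

variable {F : Type*} [Field F] {L : Type*} [LieRing L] [LieAlgebra F L]
variable {U : Type*} [AddCommGroup U] [Module F U] [LieRingModule L U] [LieModule F L U]
variable {a : LieIdeal F L} {y : L}
variable {ι : Type*} [Fintype ι] [DecidableEq ι]

variable (L) in
/-- The matrices by which the elements of `L` act on `U` relative to a basis. -/
noncomputable def toMatrixRep (b : Module.Basis ι F U) : L →ₗ[F] Matrix ι ι F where
  toFun z := LinearMap.toMatrix b b (LieModule.toEnd F L U z)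
  map_add' z z' := by rw [map_add, map_add]
  map_smul' c z := by rw [map_smul, map_smul, RingHom.id_apply]

theorem toMatrixRep_lie (b : Module.Basis ι F U) (z z' : L) :
    toMatrixRep L b ⁅z, z'⁆ =
      toMatrixRep L b z * toMatrixRep L b z' - toMatrixRep L b z' * toMatrixRep L b z := by
  change LinearMap.toMatrix b b (LieModule.toEnd F L U ⁅z, z'⁆) =
    LinearMap.toMatrix b b (LieModule.toEnd F L U z) *
      LinearMap.toMatrix b b (LieModule.toEnd F L U z') -
    LinearMap.toMatrix b b (LieModule.toEnd F L U z') *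
      LinearMap.toMatrix b b (LieModule.toEnd F L U z)
  rw [← LinearMap.toMatrix_mul, ← LinearMap.toMatrix_mul, ← map_sub]
  exact congrArg _ (LinearMap.ext fun w => lie_lie z z' w)

theorem IsDiagonalSplit.range_toMatrixRep (h : IsDiagonalSplit a y) (b : Module.Basis ι F U) :
    LinearMap.range (toMatrixRep L b) =
      Submodule.span F {toMatrixRep L b y} ⊔ a.toSubmodule.map (toMatrixRep L b) := by
  rw [LinearMap.range_eq_map, ← h.sup_eq_top, Submodule.map_sup, Submodule.map_span,
    Set.image_singleton]

theorem IsDiagonalSplit.map_toMatrixRep (h : IsDiagonalSplit a y) (b : Module.Basis ι F U) {m : ℕ}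
    (hS : ∀ δ : F, ∀ u ∈ adEigenspace a y δ, (∃ w : U, ⁅u, w⁆ ≠ 0) → ∃ j < m, δ = ((j : ℕ) : F)) :
    a.toSubmodule.map (toMatrixRep L b) =
      ⨆ j : Fin m, (adEigenspace a y ((j : ℕ) : F)).map (toMatrixRep L b) := by
  rw [← h.diagonal, Submodule.map_iSup]
  refine le_antisymm (iSup_le fun δ => ?_) (iSup_le fun j => ?_)
  · rintro _ ⟨u, hu, rfl⟩
    by_cases hw : ∃ w : U, ⁅u, w⁆ ≠ 0
    · obtain ⟨j, hj, rfl⟩ := hS δ u hu hw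
      exact Submodule.mem_iSup_of_mem ⟨j, hj⟩ ⟨u, hu, rfl⟩
    · push Not at hw
      have h₁ : LieModule.toEnd F L U u = 0 := LinearMap.ext hw
      have h₂ : toMatrixRep L b u = 0 := by
        change LinearMap.toMatrix b b (LieModule.toEnd F L U u) = 0
        rw [h₁, map_zero]
      rw [h₂]
      exact zero_mem _
  · exact le_iSup (fun δ => (adEigenspace a y δ).map (toMatrixRep L b)) ((j : ℕ) : F)

/-- If `[y, v] = v` for some `v ∈ a` that acts non-trivially, then no non-zero multiple of `y` acts
like an element of the abelian ideal `a`. -/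
theorem IsDiagonalSplit.disjoint_toMatrixRep (h : IsDiagonalSplit a y) (b : Module.Basis ι F U)
    {v : L} (hv : v ∈ adEigenspace a y 1) {w : U} (hw : ⁅v, w⁆ ≠ 0) :
    Disjoint (Submodule.span F {toMatrixRep L b y}) (a.toSubmodule.map (toMatrixRep L b)) := by
  rw [Submodule.disjoint_def]
  rintro Z hZ ⟨u, hu, rfl⟩
  obtain ⟨c, hc⟩ := Submodule.mem_span_singleton.1 hZ
  by_cases hc0 : c = 0
  · rw [← hc, hc0, zero_smul]
  exfalso
  have h₁ : toMatrixRep L b v = 0 := by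
    have h₂ := toMatrixRep_lie b u v
    rw [h.abelian u hu v hv.1, map_zero, ← hc, smul_mul_assoc, mul_smul_comm, ← smul_sub,
      ← toMatrixRep_lie, hv.2, one_smul] at h₂
    exact (smul_eq_zero.1 h₂.symm).resolve_left hc0
  have h₂ : LieModule.toEnd F L U v = 0 := (LinearMap.toMatrix b b).map_eq_zero_iff.1 h₁
  exact hw (by rw [← LieModule.toEnd_apply_apply F L U, h₂, LinearMap.zero_apply])

/-- The images of the spaces `a(j)` are independent, being eigenspaces of the commutator with the
matrix of `y`. -/
theorem iSupIndep_map_toMatrixRep (b : Module.Basis ι F U) {m : ℕ}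
    (hcast : ∀ i < m, ∀ j < m, (i : F) = (j : F) → i = j) :
    iSupIndep fun j : Fin m => (adEigenspace a y ((j : ℕ) : F)).map (toMatrixRep L b) := by
  let f : Module.End F (Matrix ι ι F) :=
    LinearMap.mulLeft F (toMatrixRep L b y) - LinearMap.mulRight F (toMatrixRep L b y)
  have hind : iSupIndep fun j : Fin m => f.eigenspace ((j : ℕ) : F) :=
    (Module.End.eigenspaces_iSupIndep f).comp
      (f := fun j : Fin m => ((j : ℕ) : F)) fun i j hij => Fin.ext (hcast i i.2 j j.2 hij)
  refine hind.mono fun j => ?_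
  rintro _ ⟨u, hu, rfl⟩
  rw [SetLike.mem_coe] at hu
  rw [Module.End.mem_eigenspace_iff]
  change toMatrixRep L b y * toMatrixRep L b u - toMatrixRep L b u * toMatrixRep L b y = _
  rw [← toMatrixRep_lie, hu.2, map_smul]

end Image

/-! ### From adapted data to shift systems -/

section Gluing

variable {F : Type*} [Field F] {L : Type*} [LieRing L] [LieAlgebra F L]
variable {U : Type*} [AddCommGroup U] [Module F U] [LieRingModule L U] [LieModule F L U]
variable {a : LieIdeal F L}

theorem eq_zero_of_comp_X_add_C_eq [CharZero F] {q : F[X]} (hq : Irreducible q) {γ : F}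
    (h : q.comp (X + C γ) = q) : γ = 0 := by
  by_contra hγ
  have heval : ∀ n : ℕ, q.eval (n * γ) = q.eval 0 := by
    intro n
    induction n with
    | zero => simp
    | succ n ih =>
      rw [← ih]
      conv_rhs => rw [← h]
      simp [add_mul]
  have hconst : q = C (q.eval 0) := by
    refine eq_of_infinite_eval_eq _ _
      (Set.infinite_of_injective_forall_mem (f := fun n : ℕ => (n : F) * γ) (fun n k hnk => ?_)
        fun n => ?_)
    · exact Nat.cast_injective (mul_right_cancel₀ hγ hnk)
    · simp [heval n]
  have := hq.natDegree_pos
  rw [hconst, natDegree_C] at this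
  exact lt_irrefl _ this

/-- In characteristic zero the conditions imposed in prime characteristic are automatic. -/
theorem stabilizer_and_cast_injective {q : F[X]} (hq : Irreducible q) {m : ℕ}
    (hchar : ∀ r : ℕ, r.Prime → CharP F r → m ≤ r ∧ ∀ γ : F, q.comp (X + C γ) = q → γ = 0) :
    (∀ γ : F, q.comp (X + C γ) = q → γ = 0) ∧
      ∀ i < m, ∀ j < m, (i : F) = (j : F) → i = j := by
  obtain ⟨r, hr⟩ := CharP.exists F
  rcases CharP.char_is_prime_or_zero F r with hp | rfl
  · obtain ⟨hmr, hstab⟩ := hchar r hp hr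
    exact ⟨hstab, fun i hi j hj hij => Nat.ModEq.eq_of_lt_of_lt
      ((CharP.natCast_eq_natCast F r).1 hij) (hi.trans_le hmr) (hj.trans_le hmr)⟩
  · have := CharP.charP_to_charZero F
    exact ⟨fun γ => eq_zero_of_comp_X_add_C_eq hq, fun i _ j _ hij => Nat.cast_injective hij⟩

/-- Data as in `IsAdapted` extend to indices in `ℕ`, and the element `v` of `a` that acts
injectively between consecutive factors then satisfies `[y, v] = v`. -/
theorem IsDiagonalSplit.exists_isShiftSystem [FiniteDimensional F U] {x : L}
    (h : IsDiagonalSplit a x)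
    (hU : IsLinked F L U) {m : ℕ} (hlen : HasNilpotencyLength F L U m) (hm : 1 < m) {y : L}
    {d : ℕ} {p : Fin m → F[X]} {s : Fin m → ℕ} (had : IsAdapted a x U hm y d p s)
    (hchar : ∀ q : ℕ, q.Prime → CharP F q →
      m ≤ q ∧ ∀ γ : F, (p ⟨0, by omega⟩).comp (X + C γ) = p ⟨0, by omega⟩ → γ = 0) :
    ∃ (v : L) (q : F[X]) (s' : ℕ → ℕ), IsShiftSystem U a y v m q s' ∧ q.natDegree = d ∧
      p = (fun i : Fin m => q.comp (X + C ((i : ℕ) : F))) ∧ s = fun i : Fin m => s' i := by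
  have hy : IsDiagonalSplit a y := by
    obtain ⟨z, hz, w, hw, rfl⟩ := Submodule.mem_sup.1 had.mem
    obtain ⟨α, rfl⟩ := Submodule.mem_span_singleton.1 hz
    refine h.smul_add hw.1 ?_
    rintro rfl
    exact had.notMem (by rwa [zero_smul, zero_add])
  obtain ⟨δ, hδ, v, hv, hinj⟩ := hy.exists_injective hU.2
  obtain ⟨hstab, hcast⟩ := stabilizer_and_cast_injective (had.irreducible _) hchar
  choose e he using fun i => exists_isFactorGenerator (had.iso i).some
  have hδ1 : δ = 1 := by
    have h₁ := (IsFactorGenerator.shift hv.2 (he ⟨0, by omega⟩) (he ⟨1, hm⟩)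
      (fun w hw => hy.mem_nilpotencySeries_succ.1 hw δ hδ v hv) (hinj 0)
      (had.monic _) (had.irreducible _) (had.monic _) (had.irreducible _) (had.pos _)).1
    rw [had.shift ⟨1, hm⟩] at h₁
    have h₂ := congrArg (fun f : F[X] => f.comp (X + C (-1))) h₁
    simp only [comp_X_add_C_comp, Nat.cast_one, add_neg_cancel, C_0, add_zero, comp_X] at h₂
    exact add_neg_eq_zero.1 (hstab _ h₂.symm)
  subst hδ1
  obtain ⟨s', rfl⟩ : ∃ s' : ℕ → ℕ, s = fun i : Fin m => s' i :=
    ⟨fun i => if hi : i < m then s ⟨i, hi⟩ else 0, funext fun i => by simp⟩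
  refine ⟨v, p ⟨0, by omega⟩, s', ?_, had.degree _, funext had.shift, rfl⟩
  exact
    { split := hy
      top := hlen.1
      mem := hv
      injective := hinj
      monic := had.monic _
      irreducible := had.irreducible _
      stabilizer := hstab
      cast_injective := hcast
      pos := fun i hi => had.pos ⟨i, hi⟩
      le := fun i hi => had.antitone (show (⟨i, by omega⟩ : Fin m) ≤ ⟨i + 1, hi⟩ from Nat.le_succ i)
      exists_generator := fun i hi => ⟨e ⟨i, hi⟩, by
        rw [← had.shift ⟨i, hi⟩]
        exact he ⟨i, hi⟩⟩ }

end Gluing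

/-! ### Semisimplicity of `x` and matrix identities -/

section Conclusions

variable {F : Type*} [Field F] {L : Type*} [LieRing L] [LieAlgebra F L]
variable {U : Type*} [AddCommGroup U] [Module F U] [LieRingModule L U] [LieModule F L U]
variable {a : LieIdeal F L} {x y v : L} {m : ℕ} {q : F[X]} {s : ℕ → ℕ} {e : ℕ → U}
variable {E : Module.End F U}

/-- `x` is semisimple along with `y`, as the two differ, up to a scalar multiple, by an element
of `a_0`, and `a_0` acts by scalars. -/
theorem IsShiftedOperator.isSemisimple_toEnd (hE : IsShiftedOperator y m e E)
    (h : IsShiftSystem U a y v m q s) (he : IsGeneratorSystem y v m q s e) (hm : 0 < m)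
    (hab : ∀ u ∈ a, ∀ u' ∈ a, ⁅u, u'⁆ = 0)
    (hs : ∀ i < m, s i = 1) (hmem : y ∈ Submodule.span F {x} ⊔ adEigenspace a x 0)
    (hnot : y ∉ adEigenspace a x 0) (hd : adEigenspace a x 0 = ⊥ ∨ q.natDegree = 1) :
    (LieModule.toEnd F L U x).IsSemisimple := by
  obtain ⟨z, hz, w₀, hw₀, rfl⟩ := Submodule.mem_sup.1 hmem
  obtain ⟨α, rfl⟩ := Submodule.mem_span_singleton.1 hz
  have hα : α ≠ 0 := by
    rintro rfl
    exact hnot (by rwa [zero_smul, zero_add])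
  obtain ⟨c, hc⟩ : ∃ c : F, LieModule.toEnd F L U w₀ = c • LinearMap.id := by
    rcases hd with h0 | hd
    · rw [h0, Submodule.mem_bot] at hw₀
      exact ⟨0, by rw [hw₀, map_zero, zero_smul]⟩
    · have hw : w₀ ∈ adEigenspace a (α • x + w₀) ((0 : ℕ) : F) := by
        have := adEigenspace_smul_add (x := x) hab hw₀.1 hα 0
        rw [mul_zero] at this
        rwa [Nat.cast_zero, this]
      obtain ⟨g, hg, hgu⟩ := hE.exists_lie_eq h he hm hw
      rw [hd, hs 0 hm, mul_one, mem_degreeLT, Nat.cast_one] at hg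
      obtain ⟨c, rfl⟩ : ∃ c, g = C c :=
        ⟨_, eq_C_of_degree_le_zero (Nat.WithBot.lt_one_iff_le_zero.1 hg)⟩
      refine ⟨c, LinearMap.ext fun w => ?_⟩
      rw [LieModule.toEnd_apply_apply, hgu, pow_zero, aeval_C, Module.End.one_apply,
        Module.algebraMap_end_apply, LinearMap.smul_apply, LinearMap.id_apply]
  exact isSemisimple_of_eq_smul_add (by rw [map_add, map_smul, hc]) hα (h.isSemisimple_toEnd hs)

variable {ι : Type*} [Fintype ι] [DecidableEq ι]

theorem toMatrix_aeval (b : Module.Basis ι F U) (f : Module.End F U) (g : F[X]) :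
    LinearMap.toMatrix b b (aeval f g) = aeval (LinearMap.toMatrix b b f) g :=
  (aeval_algHom_apply (LinearMap.toMatrixAlgEquiv b).toAlgHom f g).symm

theorem toMatrix_toEnd_eq_pow_mul_aeval (b : Module.Basis ι F U) {u : L} {j : ℕ} {g : F[X]}
    (hg : ∀ w : U, ⁅u, w⁆ = (LieModule.toEnd F L U v ^ j) (aeval E g w)) :
    LinearMap.toMatrix b b (LieModule.toEnd F L U u) =
      LinearMap.toMatrix b b (LieModule.toEnd F L U v) ^ j *
        aeval (LinearMap.toMatrix b b E) g := by
  rw [← toMatrix_aeval, LinearMap.toMatrix_pow, ← LinearMap.toMatrix_mul]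
  exact congrArg _ (LinearMap.ext hg)

theorem IsShiftedOperator.commute_toMatrix (hE : IsShiftedOperator y m e E)
    (h : IsShiftSystem U a y v m q s) (he : IsGeneratorSystem y v m q s e)
    (b : Module.Basis ι F U) (j : ℕ) (g : F[X]) :
    Commute (LinearMap.toMatrix b b (LieModule.toEnd F L U v) ^ j)
      (aeval (LinearMap.toMatrix b b E) g) := by
  rw [Commute, SemiconjBy, ← toMatrix_aeval, LinearMap.toMatrix_pow, ← LinearMap.toMatrix_mul,
    ← LinearMap.toMatrix_mul]
  exact congrArg _ (LinearMap.ext fun w => (hE.aeval_pow_apply h he g j w).symm)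

end Conclusions

end LinkedModules

open LinkedModules in
theorem mainTheorem1
    {F : Type*} [Field F] {L : Type*} [LieRing L] [LieAlgebra F L] [FiniteDimensional F L]
    -- `L = ⟨x⟩ ⋉ a` with `a` an abelian ideal on which `ad x` is diagonalizable
    (x : L) (a : LieIdeal F L) (hx : x ≠ 0)
    (hxa : IsCompl (Submodule.span F {x}) a.toSubmodule)
    (ha : IsLieAbelian a)
    (hdiag : ⨆ δ : F, adEigenspace a x δ = a.toSubmodule)
    (hF : (Infinite F ∧ PerfectField F) ∨ adEigenspace a x 0 = ⊥)
    {U : Type*} [AddCommGroup U] [Module F U] [FiniteDimensional F U]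
    [LieRingModule L U] [LieModule F L U]
    (hU : IsLinked F L U) {m : ℕ} (hlen : HasNilpotencyLength F L U m) (hm : 1 < m) :
    -- (1)
    (∃ (y : L) (d : ℕ) (p : Fin m → F[X]) (s : Fin m → ℕ), IsAdapted a x U hm y d p s) ∧
    ∀ (y : L) (d : ℕ) (p : Fin m → F[X]) (s : Fin m → ℕ), IsAdapted a x U hm y d p s →
      -- in prime characteristic `q`: `q ≥ m`, and the stabilizer of `p_1` is trivial
      (∀ q : ℕ, q.Prime → CharP F q →
        m ≤ q ∧ ∀ γ : F, (p ⟨0, by omega⟩).comp (X + C γ) = p ⟨0, by omega⟩ → γ = 0) →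
      -- (2)
      ((∃ u ∈ adEigenspace a y 1, ∃ w : U, ⁅u, w⁆ ≠ 0) ∧
        ∀ δ : F, (∃ u ∈ adEigenspace a y δ, ∃ w : U, ⁅u, w⁆ ≠ 0) →
          ∃ j : ℕ, j < m ∧ δ = (j : F)) ∧
      -- (3)
      (∃ b : Module.Basis (BlockIndex d s) F U,
        LinearMap.toMatrix b b (LieModule.toEnd F L U y) = matA d p s ∧
        ∃ v : L, v ∈ ⁅(⊤ : LieIdeal F L), (⊤ : LieIdeal F L)⁆ ∧ v ≠ 0 ∧ ⁅y, v⁆ = v ∧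
          LinearMap.toMatrix b b (LieModule.toEnd F L U v) = matT d p s ∧
          ∃ g : (j : Fin m) → adEigenspace a y ((j : ℕ) : F) →ₗ[F] degreeLT F (d * s j),
            (∃ hv : v ∈ adEigenspace a y ((1 : ℕ) : F), (g ⟨1, hm⟩ ⟨v, hv⟩ : F[X]) = 1) ∧
            (∀ (j : Fin m) (u : adEigenspace a y ((j : ℕ) : F)),
              LinearMap.toMatrix b b (LieModule.toEnd F L U (u : L)) =
                matT d p s ^ (j : ℕ) * aeval (matE d p s) (g j u : F[X])) ∧
            -- the image of `L` is `⟨A⟩ ⋉ (E_0 ⊕ E_1 T ⊕ ⋯ ⊕ E_{m-1} T^{m-1})`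
            ∃ (R : Submodule F (Matrix (BlockIndex d s) (BlockIndex d s) F))
              (W : Fin m → Submodule F (Matrix (BlockIndex d s) (BlockIndex d s) F)),
              (R : Set (Matrix (BlockIndex d s) (BlockIndex d s) F)) =
                {Z | ∃ z : L, Z = LinearMap.toMatrix b b (LieModule.toEnd F L U z)} ∧
              (∀ j : Fin m, (W j : Set (Matrix (BlockIndex d s) (BlockIndex d s) F)) =
                {Z | ∃ u : adEigenspace a y ((j : ℕ) : F),
                  Z = aeval (matE d p s) (g j u : F[X]) * matT d p s ^ (j : ℕ)}) ∧
              R = Submodule.span F {matA d p s} ⊔ ⨆ j, W j ∧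
              Disjoint (Submodule.span F {matA d p s}) (⨆ j, W j) ∧
              iSupIndep W ∧
              ∀ Z ∈ R, ∀ N ∈ ⨆ j, W j, Z * N - N * Z ∈ ⨆ j, W j) ∧
      -- (4)
      ((IsUniserialLie F L U ↔ ∀ i, s i = 1) ∧
        ((∀ i, s i = 1) →
          (LieModule.toEnd F L U y).IsSemisimple ∧
          (adEigenspace a x 0 = ⊥ ∨ d = 1 → (LieModule.toEnd F L U x).IsSemisimple))) := by
  have h : IsDiagonalSplit a x :=
    { sup_eq_top := hxa.sup_eq_top
      abelian := fun u hu u' hu' => congrArg Subtype.val (ha.trivial ⟨u, hu⟩ ⟨u', hu'⟩)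
      diagonal := hdiag }
  have hxa' : x ∉ a := fun hmem => hx
    (Submodule.disjoint_def.1 hxa.disjoint x (Submodule.mem_span_singleton_self x) hmem)
  refine ⟨h.exists_isAdapted hxa' hF hU hlen hm, fun y d p s had hchar => ?_⟩
  obtain ⟨v, q, s, hsys, rfl, rfl, rfl⟩ := h.exists_isShiftSystem hU hlen hm had hchar
  obtain ⟨e, he⟩ := hsys.exists_isGeneratorSystem
  obtain ⟨E, hE⟩ := hsys.exists_isShiftedOperator he
  have hve := hsys.lie_generator_ne_zero he hm
  have hS : ∀ δ : F, ∀ u ∈ adEigenspace a y δ, (∃ w : U, ⁅u, w⁆ ≠ 0) →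
      ∃ j < m, δ = ((j : ℕ) : F) :=
    fun δ u hu ⟨w, hw⟩ => hsys.exists_eq_natCast he hu hw
  refine ⟨⟨⟨v, hsys.mem, e 1, hve⟩, fun δ ⟨u, hu, hw⟩ => hS δ u hu hw⟩, ?_, ?_, ?_⟩
  · obtain ⟨b, hb⟩ := hsys.exists_basis he
    have hT := hsys.toMatrix_shift he hb
    have hME := hE.toMatrix hsys he hb
    have hyv : ⁅y, v⁆ = v := by rw [hsys.mem.2, one_smul]
    choose g hg using fun j : Fin m => hE.exists_linearMap hsys he j.2
    have hrep : ∀ (j : Fin m) (u : adEigenspace a y ((j : ℕ) : F)),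
        LinearMap.toMatrix b b (LieModule.toEnd F L U (u : L)) =
          matT q.natDegree (fun i : Fin m => q.comp (X + C ((i : ℕ) : F)))
            (fun i : Fin m => s i) ^ (j : ℕ) *
          aeval (matE q.natDegree (fun i : Fin m => q.comp (X + C ((i : ℕ) : F)))
            fun i : Fin m => s i) (g j u : F[X]) := by
      intro j u
      rw [← hT, ← hME]
      exact toMatrix_toEnd_eq_pow_mul_aeval b (hg j u)
    have hv : v ∈ adEigenspace a y ((1 : ℕ) : F) := by
      rw [Nat.cast_one]
      exact hsys.mem
    refine ⟨b, hsys.toMatrix_toEnd he hb, v, ?_, ?_, hyv, hT, g, ⟨hv, ?_⟩, hrep, ?_⟩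
    · rw [← hyv]
      exact LieSubmodule.lie_mem_lie (LieSubmodule.mem_top y) (LieSubmodule.mem_top v)
    · rintro rfl
      exact hve (zero_lie _)
    · exact hE.eq_one_of_lie_eq hsys he hm (g ⟨1, hm⟩ ⟨v, hv⟩).2 (hg ⟨1, hm⟩ ⟨v, hv⟩)
    have hmap := hsys.split.map_toMatrixRep b hS
    refine ⟨LinearMap.range (toMatrixRep L b),
      fun j => (adEigenspace a y ((j : ℕ) : F)).map (toMatrixRep L b), ?_, fun j => ?_, ?_, ?_,
      iSupIndep_map_toMatrixRep b hsys.cast_injective, ?_⟩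
    · ext Z
      exact ⟨fun ⟨z, hz⟩ => ⟨z, hz.symm⟩, fun ⟨z, hz⟩ => ⟨z, hz.symm⟩⟩
    · have hcomm : ∀ u : adEigenspace a y ((j : ℕ) : F), toMatrixRep L b (u : L) =
          aeval (matE q.natDegree (fun i : Fin m => q.comp (X + C ((i : ℕ) : F)))
            fun i : Fin m => s i) (g j u : F[X]) *
          matT q.natDegree (fun i : Fin m => q.comp (X + C ((i : ℕ) : F)))
            (fun i : Fin m => s i) ^ (j : ℕ) := by
        intro u
        refine (hrep j u).trans ?_
        rw [← hT, ← hME]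
        exact (hE.commute_toMatrix hsys he b j (g j u)).eq
      ext Z
      constructor
      · rintro ⟨u, hu, rfl⟩
        exact ⟨⟨u, hu⟩, hcomm ⟨u, hu⟩⟩
      · rintro ⟨u, rfl⟩
        exact ⟨u, u.2, hcomm u⟩
    · rw [← hmap, hsys.split.range_toMatrixRep b, ← hsys.toMatrix_toEnd he hb]
      rfl
    · rw [← hmap, ← hsys.toMatrix_toEnd he hb]
      exact hsys.split.disjoint_toMatrixRep b hsys.mem hve
    · rw [← hmap]
      rintro _ ⟨z, rfl⟩ _ ⟨u, hu, rfl⟩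
      rw [← toMatrixRep_lie]
      exact ⟨⁅z, u⁆, lie_mem_right F L a z u hu, rfl⟩
  · exact ⟨fun hU i => hE.eq_one_of_isUniserialLie hsys he hm hU i.2,
      fun hs => hsys.isUniserialLie fun i hi => hs ⟨i, hi⟩⟩
  · intro hs
    replace hs : ∀ i < m, s i = 1 := fun i hi => hs ⟨i, hi⟩
    exact ⟨hsys.isSemisimple_toEnd hs, fun hd =>
      hE.isSemisimple_toEnd hsys he (by omega) h.abelian hs had.mem had.notMem hd⟩
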